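/- Let $p$ be a prime, let $\mathcal F$ be a saturated fusion system on a finite $p$-group $S$, and let $E$ be an $\mathcal F$-essential subgroup of $S$ which is not contained in any other $\mathcal F$-essential subgroup. (Here $P<S$ is *$\mathcal F$-essential* if $P$ is $\mathcal F$-centric and fully $\mathcal F$-normalized and $\operatorname{Out}_{\mathcal F}(P)=\operatorname{Aut}_{\mathcal F}(P)/\operatorname{Inn}(P)$ has a strongly $p$-embedded subgroup; $\mathcal F$ is *saturated* if every subgroup of $S$ is $\mathcal F$-conjugate to one which is fully $\mathcal F$-automized and $\mathcal F$-receptive.) Let $A=N_{\operatorname{Aut}_{\mathcal F}(S)}(E)$ be the group of all $\alpha\in\operatorname{Aut}_{\mathcal F}(S)$ which leave $E$ invariant, and let $C$ be a complement to $N_{\operatorname{Inn}(S)}(E)$ in $A$. Define $S_1=N_S(E)$ and $S_i=N_S(S_{i-1})$ for $i>1$. Assume that no proper subgroup $P$ of $E$ is $S_1$-centric, that is, satisfies $C_{S_1}(P)=Z(P)$. Then, for each $i\ge 1$, $C$ leaves $S_i$ invariant, and, denoting by $C_i\le\operatorname{Aut}(S_i)$ the group of automorphisms induced by $C$ on $S_i$,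 the fusion system $$\mathcal F_i=\langle \operatorname{Inn}(S_i)C_i,\ \operatorname{Aut}_{\mathcal F}(E)\rangle$$ on $S_i$ (the smallest fusion system on $S_i$ whose morphisms include all elements of $\operatorname{Inn}(S_i)C_i$ and of $\operatorname{Aut}_{\mathcal F}(E)$) is saturated. -/

import Mathlib

/-- A fusion system on a subgroup `S` of an ambient group `G`. The ambient group only serves to
house the objects (the subgroups `P ≤ S`), so that fusion systems on `S` and on subgroups of `S`
can be compared. `Hom P Q` is empty unless `P ≤ S` and `Q ≤ S`. -/
@[ext]
structure FusionSystem {G : Type*} [Group G] (S : Subgroup G) where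
  /-- the morphisms from `P` to `Q` -/
  Hom : (P Q : Subgroup G) → Set (P →* Q)
  dom_le : ∀ {P Q : Subgroup G} {φ : P →* Q}, φ ∈ Hom P Q → P ≤ S
  cod_le : ∀ {P Q : Subgroup G} {φ : P →* Q}, φ ∈ Hom P Q → Q ≤ S
  injective : ∀ {P Q : Subgroup G} {φ : P →* Q}, φ ∈ Hom P Q → Function.Injective φ
  /-- conjugation maps by elements of `S` are morphisms (this includes identities and inclusions) -/
  conj_mem : ∀ {P Q : Subgroup G} (φ : P →* Q), P ≤ S → Q ≤ S →
    (∃ g ∈ S, ∀ x : P, (φ x : G) = g * x * g⁻¹) → φ ∈ Hom P Q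
  comp_mem : ∀ {P Q R : Subgroup G} {ψ : Q →* R} {φ : P →* Q},
    ψ ∈ Hom Q R → φ ∈ Hom P Q → ψ.comp φ ∈ Hom P R
  /-- every morphism is an isomorphism in the fusion system followed by an inclusion -/
  factor : ∀ {P Q : Subgroup G} {φ : P →* Q}, φ ∈ Hom P Q →
    ∃ (R : Subgroup G) (hR : R ≤ Q) (e : P ≃* R), e.toMonoidHom ∈ Hom P R ∧
      e.symm.toMonoidHom ∈ Hom R P ∧ φ = (Subgroup.inclusion hR).comp e.toMonoidHom

section GroupNotions

variable {G : Type*} [Group G]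

/-- `N_S(P)` -/
def normalizerIn (S P : Subgroup G) : Subgroup G := S ⊓ Subgroup.normalizer (P : Set G)

/-- `C_S(P)` -/
def centralizerIn (S P : Subgroup G) : Subgroup G := S ⊓ Subgroup.centralizer (P : Set G)

/-- `P` is `S`-centric: `C_S(P) = Z(P)`, where `Z(P) = C_P(P)`. -/
def IsCentricIn (S P : Subgroup G) : Prop := centralizerIn S P = centralizerIn P P

/-- `Aut_S(P)`: the automorphisms of `P` induced by conjugation by elements of `S`. -/
def autConj (S P : Subgroup G) : Subgroup (MulAut P) where
  carrier := {α | ∃ g ∈ S, ∀ x : P, (α x : G) = g * x * g⁻¹}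
  one_mem' := ⟨1, S.one_mem, by simp⟩
  mul_mem' := by
    rintro α β ⟨g, hg, hα⟩ ⟨h, hh, hβ⟩
    exact ⟨g * h, S.mul_mem hg hh, fun x => by
      rw [MulAut.mul_apply, hα, hβ]; group⟩
  inv_mem' := by
    rintro α ⟨g, hg, hα⟩
    refine ⟨g⁻¹, S.inv_mem hg, fun x => ?_⟩
    have h := hα (α⁻¹ x)
    rw [MulAut.apply_inv_self] at h
    rw [h]; group

/-- `Inn(P)` -/
def innerAut (P : Subgroup G) : Subgroup (MulAut P) := (MulAut.conj : P →* MulAut P).range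

instance innerAut_normal (P : Subgroup G) : (innerAut P).Normal where
  conj_mem := by
    rintro _ ⟨g, rfl⟩ α
    refine ⟨α g, ?_⟩
    ext x
    simp [MulAut.conj_apply]

/-- The automorphisms `α` of `S` with `α(E) = E`, for `E ≤ S`. -/
def autStabilizer (S E : Subgroup G) : Subgroup (MulAut S) where
  carrier := {α | ∀ x : S, (α x : G) ∈ E ↔ (x : G) ∈ E}
  one_mem' := by simp
  mul_mem' := by
    intro α β hα hβ x
    rw [MulAut.mul_apply, hα, hβ]
  inv_mem' := by
    intro α hα x
    have h := hα (α⁻¹ x)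
    rw [MulAut.apply_inv_self] at h
    exact h.symm

/-- For `C ≤ Aut(S)` and `T ≤ S`, the group of automorphisms of `T` which are restrictions of
elements of `C`. -/
def inducedAut {S T : Subgroup G} (hT : T ≤ S) (C : Subgroup (MulAut S)) :
    Subgroup (MulAut T) where
  carrier := {β | ∃ α ∈ C, ∀ x : T, (α (Subgroup.inclusion hT x) : G) = β x}
  one_mem' := ⟨1, C.one_mem, by simp⟩
  mul_mem' := by
    rintro β₁ β₂ ⟨α₁, h₁, e₁⟩ ⟨α₂, h₂, e₂⟩
    refine ⟨α₁ * α₂, C.mul_mem h₁ h₂, fun x => ?_⟩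
    have h : α₂ (Subgroup.inclusion hT x) = Subgroup.inclusion hT (β₂ x) :=
      Subtype.ext (e₂ x)
    rw [MulAut.mul_apply, MulAut.mul_apply, h, e₁]
  inv_mem' := by
    rintro β ⟨α, h, e⟩
    refine ⟨α⁻¹, C.inv_mem h, fun x => ?_⟩
    have h : α (Subgroup.inclusion hT (β⁻¹ x)) = Subgroup.inclusion hT x :=
      Subtype.ext (by rw [e, MulAut.apply_inv_self]; rfl)
    rw [← h, MulAut.inv_apply_self]
    rfl

/-- `M` is strongly `p`-embedded in the finite group `H`. -/
def IsStronglyEmbedded {H : Type*} [Group H] (p : ℕ) (M : Subgroup H) : Prop :=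
  M ≠ ⊤ ∧ p ∣ Nat.card M ∧
    ∀ g : H, g ∉ M → ¬ p ∣ Nat.card (M ⊓ M.map (MulAut.conj g).toMonoidHom : Subgroup H)

/-- `S₀ = E` and `S_{i+1} = N_S(S_i)`; in particular `S₁ = N_S(E)`. -/
def normalizerTower (S E : Subgroup G) : ℕ → Subgroup G
  | 0 => E
  | i + 1 => normalizerIn S (normalizerTower S E i)

lemma normalizerTower_le {S E : Subgroup G} (hE : E ≤ S) : ∀ i, normalizerTower S E i ≤ S
  | 0 => hE
  | _ + 1 => inf_le_left

/-- For an isomorphism `α : P → Q`, the subgroup `N_α` of those `g ∈ N_S(P)` for which the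
transport along `α` of conjugation by `g` on `P` belongs to `Aut_S(Q)`. -/
def extensionControl (S : Subgroup G) {P Q : Subgroup G} (α : P ≃* Q) : Subgroup G where
  carrier := {g | g ∈ S ∧ ∃ hg : g ∈ Subgroup.normalizer (P : Set G),
    MulAut.congr α (P.normalizerMonoidHom ⟨g, hg⟩) ∈ autConj S Q}
  one_mem' := ⟨S.one_mem, Subgroup.one_mem _, by
    have : (⟨1, Subgroup.one_mem _⟩ : Subgroup.normalizer (P : Set G)) = 1 := rfl
    rw [this, map_one, map_one]; exact Subgroup.one_mem _⟩
  mul_mem' := by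
    rintro a b ⟨ha, ha', ha''⟩ ⟨hb, hb', hb''⟩
    refine ⟨S.mul_mem ha hb, Subgroup.mul_mem _ ha' hb', ?_⟩
    have : (⟨a * b, Subgroup.mul_mem _ ha' hb'⟩ : Subgroup.normalizer (P : Set G))
      = ⟨a, ha'⟩ * ⟨b, hb'⟩ := rfl
    rw [this, map_mul, map_mul]; exact Subgroup.mul_mem _ ha'' hb''
  inv_mem' := by
    rintro a ⟨ha, ha', ha''⟩
    refine ⟨S.inv_mem ha, Subgroup.inv_mem _ ha', ?_⟩
    have : (⟨a⁻¹, Subgroup.inv_mem _ ha'⟩ : Subgroup.normalizer (P : Set G))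
      = ⟨a, ha'⟩⁻¹ := rfl
    rw [this, map_inv, map_inv]; exact Subgroup.inv_mem _ ha''

lemma le_extensionControl {S P Q : Subgroup G} (hP : P ≤ S) (hQ : Q ≤ S) (α : P ≃* Q) :
    P ≤ extensionControl S α := by
  intro g hg
  refine ⟨hP hg, Subgroup.le_normalizer hg, (α ⟨g, hg⟩ : G), hQ (α ⟨g, hg⟩).2, fun x => ?_⟩
  obtain ⟨y, rfl⟩ := α.surjective x
  have h : P.normalizerMonoidHom ⟨g, Subgroup.le_normalizer hg⟩ y
      = ⟨g, hg⟩ * y * ⟨g, hg⟩⁻¹ := rfl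
  simp [MulAut.congr, h]

/-- The automorphisms in `A`, regarded as homomorphisms between subgroups of `G`. -/
def autMorphisms {P : Subgroup G} (A : Subgroup (MulAut P)) :
    Set (Σ P : Subgroup G, Σ Q : Subgroup G, P →* Q) :=
  {m | ∃ α ∈ A, m = ⟨P, P, α.toMonoidHom⟩}

end GroupNotions

namespace FusionSystem

variable {G : Type*} [Group G] {S : Subgroup G}

/-- The morphism set of `F` contains `X`. -/
def Contains (F : FusionSystem S) (X : Set (Σ P : Subgroup G, Σ Q : Subgroup G, P →* Q)) : Prop :=
  ∀ m ∈ X, m.2.2 ∈ F.Hom m.1 m.2.1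

lemma iso_mem_of_comp_mem (F : FusionSystem S) {P Q R : Subgroup G} (hR : R ≤ Q) (e : P ≃* R)
    (h : (Subgroup.inclusion hR).comp e.toMonoidHom ∈ F.Hom P Q) :
    e.toMonoidHom ∈ F.Hom P R ∧ e.symm.toMonoidHom ∈ F.Hom R P := by
  obtain ⟨R', hR', e', h₁, h₂, h₃⟩ := F.factor h
  have key : ∀ x : P, (e x : G) = e' x := fun x => congrArg Subtype.val (DFunLike.congr_fun h₃ x)
  have hRR : R = R' := by
    ext g
    constructor
    · intro hg
      have := key (e.symm ⟨g, hg⟩)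
      rw [MulEquiv.apply_symm_apply] at this
      change g = _ at this
      rw [this]; exact (e' _).2
    · intro hg
      have := key (e'.symm ⟨g, hg⟩)
      rw [MulEquiv.apply_symm_apply] at this
      change _ = g at this
      rw [← this]; exact (e _).2
  subst hRR
  obtain rfl : e = e' := MulEquiv.ext fun x => Subtype.ext (key x)
  exact ⟨h₁, h₂⟩

/-- The fusion system on `S` generated by a set `X` of monomorphisms between subgroups of `S`:
the intersection of all fusion systems on `S` whose morphism set contains `X`. -/
def generate (S : Subgroup G) (X : Set (Σ P : Subgroup G, Σ Q : Subgroup G, P →* Q)) :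
    FusionSystem S where
  Hom P Q := {φ | P ≤ S ∧ Q ≤ S ∧ Function.Injective φ ∧
    ∀ F : FusionSystem S, F.Contains X → φ ∈ F.Hom P Q}
  dom_le h := h.1
  cod_le h := h.2.1
  injective h := h.2.2.1
  conj_mem := by
    rintro P Q φ hP hQ ⟨g, hg, h⟩
    refine ⟨hP, hQ, fun x y hxy => ?_, fun F _ => F.conj_mem φ hP hQ ⟨g, hg, h⟩⟩
    have := congrArg Subtype.val hxy
    rw [h, h] at this
    exact Subtype.ext (by simpa using this)
  comp_mem := by
    rintro P Q R ψ φ ⟨_, hR, iψ, hψ⟩ ⟨hP, _, iφ, hφ⟩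
    exact ⟨hP, hR, iψ.comp iφ, fun F hF => F.comp_mem (hψ F hF) (hφ F hF)⟩
  factor := by
    rintro P Q φ ⟨hP, hQ, iφ, hφ⟩
    have hR : φ.range.map Q.subtype ≤ Q := by
      rintro _ ⟨y, _, rfl⟩
      exact y.2
    let e : P ≃* (φ.range.map Q.subtype : Subgroup G) :=
      (MonoidHom.ofInjective iφ).trans
        (φ.range.equivMapOfInjective Q.subtype Q.subtype_injective)
    have he : φ = (Subgroup.inclusion hR).comp e.toMonoidHom := by
      ext x
      rfl
    refine ⟨_, hR, e, ⟨hP, hR.trans hQ, e.injective, fun F hF => ?_⟩,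
      ⟨hR.trans hQ, hP, e.symm.injective, fun F hF => ?_⟩, he⟩
    · exact (F.iso_mem_of_comp_mem hR e (he ▸ hφ F hF)).1
    · exact (F.iso_mem_of_comp_mem hR e (he ▸ hφ F hF)).2

variable (F : FusionSystem S)

/-- `Q` belongs to the `F`-conjugacy class of `P`. -/
def IsConjugate (P Q : Subgroup G) : Prop := ∃ α : P ≃* Q, α.toMonoidHom ∈ F.Hom P Q

/-- `Aut_F(P)` -/
def autF {P : Subgroup G} (hP : P ≤ S) : Subgroup (MulAut P) where
  carrier := {α | α.toMonoidHom ∈ F.Hom P P}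
  one_mem' := F.conj_mem _ hP hP ⟨1, S.one_mem, fun x => by simp⟩
  mul_mem' := fun hα hβ => F.comp_mem hα hβ
  inv_mem' := by
    intro α hα
    exact (F.iso_mem_of_comp_mem le_rfl α hα).2

/-- `Out_F(P) = Aut_F(P) / Inn(P)` -/
abbrev outF {P : Subgroup G} (hP : P ≤ S) : Type _ :=
  F.autF hP ⧸ (innerAut P).subgroupOf (F.autF hP)

/-- `P` is fully `F`-normalized. -/
def IsFullyNormalized (P : Subgroup G) : Prop :=
  ∀ Q, F.IsConjugate P Q → Nat.card (normalizerIn S Q) ≤ Nat.card (normalizerIn S P)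

/-- `P` is fully `F`-automized: `Aut_S(P)` is a Sylow `p`-subgroup of `Aut_F(P)`. -/
def IsFullyAutomized (p : ℕ) {P : Subgroup G} (hP : P ≤ S) : Prop :=
  ∃ T : Sylow p (F.autF hP), (T : Subgroup (F.autF hP)) = (autConj S P).subgroupOf (F.autF hP)

/-- `P` is `F`-centric. -/
def IsCentric (P : Subgroup G) : Prop := ∀ Q, F.IsConjugate P Q → IsCentricIn S Q

/-- `P` is `F`-essential. -/
def IsEssential (p : ℕ) (P : Subgroup G) : Prop :=
  ∃ hP : P < S, F.IsCentric P ∧ F.IsFullyNormalized P ∧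
    ∃ M : Subgroup (F.outF hP.le), IsStronglyEmbedded p M

/-- `Q` is `F`-receptive: each isomorphism `α : P → Q` in `F` extends to a morphism
`N_α → S` in `F`. -/
def IsReceptive {Q : Subgroup G} (hQ : Q ≤ S) : Prop :=
  ∀ (P : Subgroup G) (hP : P ≤ S) (α : P ≃* Q), α.toMonoidHom ∈ F.Hom P Q →
    ∃ β ∈ F.Hom (extensionControl S α) S,
      ∀ x : P, (β (Subgroup.inclusion (le_extensionControl hP hQ α) x) : G) = α x

/-- `F` is saturated: each subgroup of `S` is `F`-conjugate to a subgroup which is fully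
`F`-automized and `F`-receptive. -/
def IsSaturated (p : ℕ) : Prop :=
  ∀ P : Subgroup G, P ≤ S → ∃ (Q : Subgroup G) (hQ : Q ≤ S),
    F.IsConjugate P Q ∧ F.IsFullyAutomized p hQ ∧ F.IsReceptive hQ

end FusionSystem

/-! Let `Δ = Aut_F(S)`. A morphism of `F` defined on a subgroup `R` properly containing `E` is a
restriction of an element of `Δ`: at a maximal counterexample `R`, which may be taken fully
automized and receptive, the automorphisms of `R` induced by `Δ` form a proper subgroup of
`Aut_F(R)` containing the extensible ones, so `R` is essential, against the maximality of `E`. Hence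
`E` is itself fully automized and receptive, and an element of `Aut_F(E)` which extends beyond `E`
is induced by `N_Δ(E)`, that is, by elements of `N_S(E)` and of `C`.

Put `K = Inn(T) C_T` and `D = Aut_F(E)`, where `N_S(E) ≤ T ≤ S` and `C` stabilizes `T`. Isomorphisms
in the system on `T` generated by `K` and `D` are composites of restrictions of members of `K` and
of `D`. A subgroup which `K` does not move into `E` is therefore only mapped by `K`, and `E` is
handled by the previous paragraph. If `K` moves `P` properly into `E`, then no conjugate of `P`
contains its centralizer in `T`. A conjugate `Q` of `P` can be chosen so that the normalizers of all
other conjugates map into its own, and then every automorphism of `Q` extends to `Q C_T(Q) > Q`.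
Saturation at the class of `P` is thus inherited from larger subgroups, by downward induction on the
order.
-/

section GroupLemmas

variable {H : Type*} [Group H]

theorem relIndex_map_map_dvd {H' : Type*} [Group H'] (φ : H →* H') (A B : Subgroup H) :
    (A.map φ).relIndex (B.map φ) ∣ A.relIndex B := by
  have hle : (A.subgroupOf B).map (φ.subgroupMap B) ≤ (A.map φ).subgroupOf (B.map φ) := by
    rintro _ ⟨x, hx, rfl⟩
    exact ⟨x, hx, rfl⟩
  exact (Subgroup.index_dvd_of_le hle).trans
    (Subgroup.index_map_dvd _ (φ.subgroupMap_surjective B))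

theorem relIndex_dvd_relIndex_of_normal (N : Subgroup H) [N.Normal] {K L : Subgroup H}
    (h : L ≤ K) : N.relIndex L ∣ N.relIndex K := by
  rw [← Subgroup.relIndex_subgroupOf h]
  exact Subgroup.relIndex_dvd_index_of_normal _ _

theorem exists_map_conj_le_of_le_sup [Finite H] {p : ℕ} [Fact p.Prime] {N P Y : Subgroup H}
    (hP : IsPGroup p P) (hPN : P ≤ Subgroup.normalizer (N : Set H))
    (hi : ¬ p ∣ P.relIndex (N ⊔ P)) (hY : IsPGroup p Y) (hYN : Y ≤ N ⊔ P) :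
    ∃ n ∈ N, Y.map (MulAut.conj n).toMonoidHom ≤ P := by
  have hP' : IsPGroup p (P.subgroupOf (N ⊔ P)) := hP.comap_subtype
  obtain ⟨Q, hQ⟩ := (hY.comap_subtype (K := N ⊔ P)).exists_le_sylow
  obtain ⟨d, hd⟩ := MulAction.exists_smul_eq (N ⊔ P : Subgroup H) Q (hP'.toSylow hi)
  have hd_mem : open Pointwise in (d : H) ∈ (P : Set H) * (N : Set H) := by
    rw [← Subgroup.coe_mul_of_left_le_normalizer_right P N hPN, sup_comm]
    exact d.2
  obtain ⟨x, hx, n, hn, hxn⟩ := Set.mem_mul.1 hd_mem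
  refine ⟨n, hn, ?_⟩
  rintro _ ⟨y, hy, rfl⟩
  have hconj : MulAut.conj d • (⟨y, hYN hy⟩ : (N ⊔ P : Subgroup H)) ∈ (d • Q : Sylow p _) :=
    Subgroup.smul_mem_pointwise_smul _ (MulAut.conj d) Q.toSubgroup
      (hQ (Subgroup.mem_subgroupOf.2 hy))
  rw [hd] at hconj
  have hdy : (d : H) * y * (d : H)⁻¹ ∈ P := hconj
  have : n * y * n⁻¹ = x⁻¹ * (d * y * (d : H)⁻¹) * x := by rw [← hxn]; group
  simpa [this] using P.mul_mem (P.mul_mem (P.inv_mem hx) hdy) hx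

theorem exists_not_dvd_relIndex_map_conj [Finite H] {p : ℕ} [Fact p.Prime] {K L P : Subgroup H}
    (hPK : P ≤ K) (hP : IsPGroup p P) (hi : ¬ p ∣ P.relIndex K) (hLK : L ≤ K) :
    ∃ h ∈ K, ¬ p ∣ P.relIndex (L.map (MulAut.conj h).toMonoidHom) := by
  obtain ⟨Y⟩ : Nonempty (Sylow p L) := inferInstance
  have hYL : (Y : Subgroup L).map L.subtype ≤ L := Subgroup.map_subtype_le _
  obtain ⟨h, hh, hYP⟩ := exists_map_conj_le_of_le_sup hP (hPK.trans Subgroup.le_normalizer)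
    (by rwa [sup_of_le_left hPK]) (Y.2.map L.subtype) (hYL.trans (hLK.trans le_sup_left))
  refine ⟨h, hh, fun hd => Y.not_dvd_index (hd.trans ?_)⟩
  refine (Subgroup.relIndex_dvd_of_le_left _ hYP).trans ?_
  rw [Subgroup.relIndex_map_map_of_injective _ _ (MulAut.conj h).injective, Subgroup.relIndex,
    Subgroup.subgroupOf, Subgroup.comap_map_eq_self_of_injective L.subtype_injective]

theorem exists_mem_normalizer_notMem {p : ℕ} [Fact p.Prime] {P R : Subgroup H} [Finite R]
    (hR : IsPGroup p R) (h : P < R) :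
    ∃ g ∈ R, g ∈ Subgroup.normalizer (P : Set H) ∧ g ∉ P := by
  have : Group.IsNilpotent R := hR.isNilpotent
  have hlt : P.subgroupOf R < ⊤ := lt_top_iff_ne_top.2 fun hPR =>
    h.not_ge (Subgroup.subgroupOf_eq_top.1 hPR)
  obtain ⟨g, hg, hgP⟩ := SetLike.exists_of_lt
    (Group.normalizerCondition_of_isNilpotent (G := R) _ hlt)
  rw [← Subgroup.subgroupOf_normalizer_eq h.le] at hg
  exact ⟨g, g.2, hg, hgP⟩

end GroupLemmas

open Classical in
/-- The extension of a map `P → Q` between subgroups of `G` to a function on `G`, by the identity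
outside `P`. Morphisms of a fusion system are handled through such functions, because restriction
and composition then need no transport between subtypes. -/
noncomputable def extendFun {G : Type*} [Group G] {P Q : Subgroup G} (φ : P → Q) : G → G :=
  fun x => if h : x ∈ P then φ ⟨x, h⟩ else x

theorem extendFun_of_mem {G : Type*} [Group G] {P Q : Subgroup G} (φ : P → Q) {x : G}
    (hx : x ∈ P) : extendFun φ x = φ ⟨x, hx⟩ :=
  dif_pos hx

theorem extendFun_coe {G : Type*} [Group G] {P Q : Subgroup G} (φ : P → Q) (x : P) :
    extendFun φ x = φ x :=
  extendFun_of_mem φ x.2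

namespace FusionSystem

variable {G : Type*} [Group G] {S : Subgroup G}

/-- The function `f` restricts to an isomorphism `P → Q` in `F`. -/
def IsoOn (F : FusionSystem S) (P Q : Subgroup G) (f : G → G) : Prop :=
  ∃ α : P ≃* Q, α.toMonoidHom ∈ F.Hom P Q ∧ ∀ x : P, (α x : G) = f x

/-- The function `f` restricts to a morphism in `F` defined on `P`; its codomain does not
matter. -/
def MorOn (F : FusionSystem S) (P : Subgroup G) (f : G → G) : Prop := ∃ Q, F.IsoOn P Q f

variable {F : FusionSystem S} {P Q R P' Q' : Subgroup G} {f g : G → G}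

theorem isoOn_extendFun {α : P ≃* Q} (h : α.toMonoidHom ∈ F.Hom P Q) :
    F.IsoOn P Q (extendFun α) :=
  ⟨α, h, fun x => (extendFun_coe α x).symm⟩

namespace IsoOn

theorem dom_le (h : F.IsoOn P Q f) : P ≤ S :=
  let ⟨_, hα, _⟩ := h
  F.dom_le hα

theorem cod_le (h : F.IsoOn P Q f) : Q ≤ S :=
  let ⟨_, hα, _⟩ := h
  F.cod_le hα

theorem apply_mem (h : F.IsoOn P Q f) {x : G} (hx : x ∈ P) : f x ∈ Q := by
  obtain ⟨α, _, h⟩ := h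
  rw [← h ⟨x, hx⟩]
  exact (α _).2

theorem injOn (h : F.IsoOn P Q f) : Set.InjOn f P := by
  obtain ⟨α, _, h⟩ := h
  intro x hx y hy hxy
  have : α ⟨x, hx⟩ = α ⟨y, hy⟩ := Subtype.ext (by rwa [h, h])
  exact congrArg Subtype.val (α.injective this)

theorem surjOn (h : F.IsoOn P Q f) : Set.SurjOn f P Q := by
  obtain ⟨α, _, h⟩ := h
  intro y hy
  exact ⟨α.symm ⟨y, hy⟩, (α.symm _).2, by rw [← h, MulEquiv.apply_symm_apply]⟩

theorem image_eq (h : F.IsoOn P Q f) : f '' P = Q :=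
  subset_antisymm (Set.image_subset_iff.2 fun _ => h.apply_mem) h.surjOn

theorem map_mul (h : F.IsoOn P Q f) {x y : G} (hx : x ∈ P) (hy : y ∈ P) :
    f (x * y) = f x * f y := by
  obtain ⟨α, _, h⟩ := h
  have hxy := h (⟨x, hx⟩ * ⟨y, hy⟩)
  rw [_root_.map_mul, Subgroup.coe_mul, h, h] at hxy
  exact hxy.symm

theorem map_inv (h : F.IsoOn P Q f) {x : G} (hx : x ∈ P) : f x⁻¹ = (f x)⁻¹ := by
  obtain ⟨α, _, h⟩ := h
  have hx' := h (⟨x, hx⟩ : P)⁻¹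
  rw [_root_.map_inv, Subgroup.coe_inv, h] at hx'
  exact hx'.symm

theorem map_conj (h : F.IsoOn P Q f) {x y : G} (hx : x ∈ P) (hy : y ∈ P) :
    f (x * y * x⁻¹) = f x * f y * (f x)⁻¹ := by
  rw [h.map_mul (P.mul_mem hx hy) (P.inv_mem hx), h.map_mul hx hy, h.map_inv hx]

theorem card_eq (h : F.IsoOn P Q f) : Nat.card P = Nat.card Q :=
  let ⟨α, _, _⟩ := h
  Nat.card_congr α.toEquiv

theorem congr (h : F.IsoOn P Q f) (hfg : Set.EqOn g f P) : F.IsoOn P Q g := by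
  obtain ⟨α, hα, h⟩ := h
  exact ⟨α, hα, fun x => by rw [h, hfg x.2]⟩

theorem refl (hP : P ≤ S) : F.IsoOn P P id :=
  ⟨MulEquiv.refl P, F.conj_mem _ hP hP ⟨1, S.one_mem, fun x => by simp⟩, fun _ => rfl⟩

theorem comp (hg : F.IsoOn Q R g) (hf : F.IsoOn P Q f) : F.IsoOn P R (g ∘ f) := by
  obtain ⟨α, hα, ha⟩ := hf
  obtain ⟨β, hβ, hb⟩ := hg
  exact ⟨α.trans β, F.comp_mem hβ hα, fun x => by simp [hb, ha]⟩

theorem symm (h : F.IsoOn P Q f) : ∃ g, F.IsoOn Q P g ∧ Set.InvOn g f P Q := by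
  obtain ⟨α, hα, ha⟩ := h
  refine ⟨extendFun α.symm, isoOn_extendFun (F.iso_mem_of_comp_mem le_rfl α hα).2,
    fun x hx => ?_, fun y hy => ?_⟩
  · rw [← ha ⟨x, hx⟩, extendFun_coe, α.symm_apply_apply]
  · rw [extendFun_of_mem _ hy, ← ha, α.apply_symm_apply]

theorem morOn (h : F.IsoOn P Q f) : F.MorOn P f := ⟨Q, h⟩

theorem isConjugate (h : F.IsoOn P Q f) : F.IsConjugate P Q :=
  let ⟨α, hα, _⟩ := h
  ⟨α, hα⟩

end IsoOn

theorem isConjugate_iff : F.IsConjugate P Q ↔ ∃ f, F.IsoOn P Q f :=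
  ⟨fun ⟨_, hα⟩ => ⟨_, isoOn_extendFun hα⟩, fun ⟨_, h⟩ => h.isConjugate⟩

theorem exists_isoOn_of_mem_hom {φ : P →* Q} (hφ : φ ∈ F.Hom P Q) :
    ∃ R ≤ Q, F.IsoOn P R (extendFun φ) := by
  obtain ⟨R, hR, e, he, _, rfl⟩ := F.factor hφ
  exact ⟨R, hR, e, he, fun x => by rw [extendFun_coe]; rfl⟩

theorem inclusion_mem_hom (hPQ : P ≤ Q) (hQ : Q ≤ S) : Subgroup.inclusion hPQ ∈ F.Hom P Q :=
  F.conj_mem _ (hPQ.trans hQ) hQ ⟨1, S.one_mem, fun x => by simp⟩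

namespace IsoOn

theorem exists_mem_hom (h : F.IsoOn P R f) (hRQ : R ≤ Q) (hQ : Q ≤ S) :
    ∃ φ ∈ F.Hom P Q, ∀ x : P, (φ x : G) = f x := by
  obtain ⟨α, hα, h⟩ := h
  exact ⟨(Subgroup.inclusion hRQ).comp α.toMonoidHom,
    F.comp_mem (inclusion_mem_hom hRQ hQ) hα, h⟩

theorem restrict (h : F.IsoOn P Q f) (hP' : P' ≤ P) : ∃ Q' ≤ Q, F.IsoOn P' Q' f := by
  obtain ⟨α, hα, h⟩ := h
  obtain ⟨R, hR, hi⟩ := exists_isoOn_of_mem_hom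
    (F.comp_mem hα (inclusion_mem_hom hP' (F.dom_le hα)))
  refine ⟨R, hR, hi.congr fun x hx => ?_⟩
  rw [extendFun_of_mem _ hx, ← h ⟨x, hP' hx⟩]
  rfl

theorem restrict_of_image_eq (h : F.IsoOn P Q f) (hP' : P' ≤ P) (him : f '' P' = Q') :
    F.IsoOn P' Q' f := by
  obtain ⟨R, _, hi⟩ := h.restrict hP'
  rwa [← SetLike.coe_injective (hi.image_eq.symm.trans him)]

end IsoOn

theorem MorOn.restrict (h : F.MorOn P f) (hP' : P' ≤ P) : F.MorOn P' f :=
  let ⟨_, h⟩ := h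
  let ⟨_, _, h'⟩ := h.restrict hP'
  h'.morOn

theorem mem_autF_iff {hP : P ≤ S} {α : MulAut P} :
    α ∈ F.autF hP ↔ F.IsoOn P P (extendFun α) := by
  refine ⟨fun h => isoOn_extendFun h, fun ⟨β, hβ, h⟩ => ?_⟩
  rwa [show β = α from MulEquiv.ext fun x => Subtype.ext (by rw [h, extendFun_coe])] at hβ

theorem IsoOn.exists_mem_autF (h : F.IsoOn P P f) :
    ∃ α ∈ F.autF h.dom_le, ∀ x : P, (α x : G) = f x :=
  h

/-- Receptivity in terms of functions on the ambient group: an isomorphism `f : P → Q` in `F`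
extends to every `P Y`, where `Y ≤ N_S(P)`, such that `f` transports the action of `Y` on `P` into
`Aut_S(Q)`. The largest such `Y` is `extensionControl`. -/
def Receptive (F : FusionSystem S) (Q : Subgroup G) : Prop :=
  ∀ ⦃P Y : Subgroup G⦄ ⦃f : G → G⦄, F.IsoOn P Q f → Y ≤ normalizerIn S P →
    (∀ y ∈ Y, ∃ t ∈ S, ∀ x ∈ P, f (y * x * y⁻¹) = t * f x * t⁻¹) →
    ∃ f', F.MorOn (P ⊔ Y) f' ∧ Set.EqOn f' f P

theorem coe_congr_normalizerMonoidHom {α : P ≃* Q} (hα : ∀ x : P, (α x : G) = f x)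
    (n : Subgroup.normalizer (P : Set G)) (x : P) :
    (MulAut.congr α (P.normalizerMonoidHom n) (α x) : G) = f (n * x * (n : G)⁻¹) := by
  rw [show MulAut.congr α (P.normalizerMonoidHom n) (α x) = α (P.normalizerMonoidHom n x) by
    simp [MulAut.congr], hα]
  rfl

theorem mem_extensionControl_iff {α : P ≃* Q} (hα : ∀ x : P, (α x : G) = f x) {g : G} :
    g ∈ extensionControl S α ↔ g ∈ normalizerIn S P ∧
      ∃ t ∈ S, ∀ x ∈ P, f (g * x * g⁻¹) = t * f x * t⁻¹ := by
  constructor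
  · rintro ⟨hg, hn, t, ht, h⟩
    refine ⟨⟨hg, hn⟩, t, ht, fun x hx => ?_⟩
    rw [← hα ⟨x, hx⟩, ← h, coe_congr_normalizerMonoidHom hα]
  · rintro ⟨⟨hg, hn⟩, t, ht, h⟩
    refine ⟨hg, hn, t, ht, fun y => ?_⟩
    obtain ⟨x, rfl⟩ := α.surjective y
    rw [coe_congr_normalizerMonoidHom hα, hα, h x x.2]

theorem isReceptive_iff (hQ : Q ≤ S) : F.IsReceptive hQ ↔ F.Receptive Q := by
  constructor
  · intro h P Y f hf hYP hYf
    have hP := hf.dom_le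
    obtain ⟨α, hα, ha⟩ := hf
    obtain ⟨β, hβ, hb⟩ := h P hP α hα
    obtain ⟨R, _, hi⟩ := exists_isoOn_of_mem_hom hβ
    have hle : P ⊔ Y ≤ extensionControl S α := sup_le (le_extensionControl hP hQ α) fun y hy =>
      (mem_extensionControl_iff ha).2 ⟨hYP hy, hYf y hy⟩
    refine ⟨_, hi.morOn.restrict hle, fun x hx => ?_⟩
    rw [extendFun_of_mem _ (hle (Subgroup.mem_sup_left hx))]
    exact (hb ⟨x, hx⟩).trans (ha ⟨x, hx⟩)
  · intro h P hP α hα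
    have hmem (g : G) := mem_extensionControl_iff (S := S) (g := g)
      fun x => (extendFun_coe α x).symm
    obtain ⟨f', hf', hα'⟩ := h (isoOn_extendFun hα) (fun g hg => ((hmem g).1 hg).1)
      fun g hg => ((hmem g).1 hg).2
    rw [sup_of_le_right (le_extensionControl hP hQ α)] at hf'
    obtain ⟨Z, hZ⟩ := hf'
    obtain ⟨φ, hφ, he⟩ := hZ.exists_mem_hom hZ.cod_le le_rfl
    refine ⟨φ, hφ, fun x => ?_⟩
    rw [he, ← extendFun_coe α x]
    exact hα' x.2

/-- `Aut_S(P)` has index prime to `p` in `Aut_F(P)`; for finite `p`-groups `S` this says that `P`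
is fully automized. -/
def Automized (F : FusionSystem S) (p : ℕ) {P : Subgroup G} (hP : P ≤ S) : Prop :=
  ¬ p ∣ (autConj S P).relIndex (F.autF hP)

theorem autConj_le_autF (hP : P ≤ S) : autConj S P ≤ F.autF hP :=
  fun _ hα => F.conj_mem _ hP hP hα

theorem mem_normalizer_of_conj {α : MulAut P} {g : G} (h : ∀ x : P, (α x : G) = g * x * g⁻¹) :
    g ∈ Subgroup.normalizer (P : Set G) := by
  refine Subgroup.mem_normalizer_iff.2 fun x => ⟨fun hx => ?_, fun hx => ?_⟩
  · rw [← h ⟨x, hx⟩]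
    exact (α _).2
  · have hx' := h (α⁻¹ ⟨_, hx⟩)
    rw [MulAut.apply_inv_self] at hx'
    rw [show x = (α⁻¹ ⟨_, hx⟩ : P) by simpa using hx']
    exact (α⁻¹ _).2

theorem isPGroup_autConj {p : ℕ} (hS : IsPGroup p S) : IsPGroup p (autConj S P) := by
  have hle : autConj S P ≤
      ((normalizerIn S P).subgroupOf (Subgroup.normalizer (P : Set G))).map
        P.normalizerMonoidHom := by
    rintro α ⟨g, hg, h⟩
    refine ⟨⟨g, mem_normalizer_of_conj h⟩, ⟨hg, mem_normalizer_of_conj h⟩, ?_⟩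
    exact MulEquiv.ext fun x => Subtype.ext (h x).symm
  exact (((hS.to_le inf_le_left).comap_subtype).map _).to_le hle

theorem isFullyAutomized_iff {p : ℕ} [Fact p.Prime] [Finite S] (hS : IsPGroup p S) (hP : P ≤ S) :
    F.IsFullyAutomized p hP ↔ F.Automized p hP := by
  have : Finite P := Finite.of_injective _ (Subgroup.inclusion_injective hP)
  constructor
  · rintro ⟨T, hT⟩ h
    apply T.not_dvd_index
    rwa [hT]
  · intro h
    exact ⟨(isPGroup_autConj hS).comap_subtype.toSylow h, rfl⟩

/-- `P` is conjugate in `F` to a fully automized and receptive subgroup. -/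
def SaturatedAt (F : FusionSystem S) (p : ℕ) (P : Subgroup G) : Prop :=
  ∃ (Q : Subgroup G) (hQ : Q ≤ S) (f : G → G), F.IsoOn P Q f ∧ F.Automized p hQ ∧ F.Receptive Q

theorem isSaturated_iff {p : ℕ} [Fact p.Prime] [Finite S] (hS : IsPGroup p S) :
    F.IsSaturated p ↔ ∀ P ≤ S, F.SaturatedAt p P := by
  refine forall₂_congr fun P _ => exists₂_congr fun Q hQ => ?_
  rw [isConjugate_iff, isFullyAutomized_iff hS, isReceptive_iff]
  simp only [exists_and_right]

theorem SaturatedAt.of_isoOn {p : ℕ} (h : F.SaturatedAt p Q) (hf : F.IsoOn P Q f) :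
    F.SaturatedAt p P := by
  obtain ⟨R, hR, g, hg, h⟩ := h
  exact ⟨R, hR, _, hg.comp hf, h⟩

end FusionSystem

section Normalizers

variable {G : Type*} [Group G] {S P R : Subgroup G}

theorem le_normalizerIn (hP : P ≤ S) : P ≤ normalizerIn S P :=
  le_inf hP Subgroup.le_normalizer

theorem centralizerIn_le_normalizerIn : centralizerIn S P ≤ normalizerIn S P :=
  inf_le_inf_left S (Subgroup.centralizer_le_normalizer _)

theorem card_le_of_le_of_le [Finite S] (hR : R ≤ S) (h : P ≤ R) : Nat.card P ≤ Nat.card R :=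
  have : Finite R := Finite.of_injective _ (Subgroup.inclusion_injective hR)
  Subgroup.card_le_of_le h

theorem eq_of_le_of_card_le [Finite S] (hR : R ≤ S) (h : P ≤ R) (hc : Nat.card R ≤ Nat.card P) :
    P = R :=
  have : Finite R := Finite.of_injective _ (Subgroup.inclusion_injective hR)
  Subgroup.eq_of_le_of_card_ge h hc

theorem card_lt_of_lt_of_le [Finite S] (hR : R ≤ S) (h : P < R) : Nat.card P < Nat.card R :=
  lt_of_not_ge fun hc => h.ne (eq_of_le_of_card_le hR h.le hc)

theorem exists_mem_normalizerIn_notMem {p : ℕ} [Fact p.Prime] [Finite S] (hS : IsPGroup p S)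
    (hR : R ≤ S) (h : P < R) : ∃ g ∈ R, g ∈ normalizerIn S P ∧ g ∉ P := by
  have : Finite R := Finite.of_injective _ (Subgroup.inclusion_injective hR)
  obtain ⟨g, hg, hn, hP⟩ := exists_mem_normalizer_notMem (hS.to_le hR) h
  exact ⟨g, hg, ⟨hR hg, hn⟩, hP⟩

theorem lt_normalizerIn {p : ℕ} [Fact p.Prime] [Finite S] (hS : IsPGroup p S) (h : P < S) :
    P < normalizerIn S P :=
  have ⟨_, _, hg, hgP⟩ := exists_mem_normalizerIn_notMem hS le_rfl h
  SetLike.lt_iff_le_and_exists.2 ⟨le_normalizerIn h.le, _, hg, hgP⟩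

end Normalizers

section Automorphisms

variable {G : Type*} [Group G] {R Q : Subgroup G}

/-- The automorphisms of `R` which are the identity on `Q ∩ R`. -/
def autFixing (R Q : Subgroup G) : Subgroup (MulAut R) where
  carrier := {α | ∀ x : R, (x : G) ∈ Q → α x = x}
  one_mem' := by simp
  mul_mem' := by
    intro α β hα hβ x hx
    rw [MulAut.mul_apply, hβ x hx, hα x hx]
  inv_mem' := by
    intro α hα x hx
    rw [MulAut.inv_apply, MulEquiv.symm_apply_eq, hα x hx]

theorem autFixing_le_autStabilizer : autFixing R Q ≤ autStabilizer R Q := by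
  refine fun α hα x => ⟨fun hx => ?_, fun hx => by rwa [hα x hx]⟩
  rwa [← α.injective (hα _ hx)]

theorem autStabilizer_le_normalizer_autFixing :
    autStabilizer R Q ≤ Subgroup.normalizer (autFixing R Q : Set (MulAut R)) := by
  refine Subgroup.le_normalizer_iff.2 fun α hα β hβ x hx => ?_
  have hx' : (α⁻¹ x : G) ∈ Q := (inv_mem hα x).2 hx
  rw [MulAut.mul_apply, MulAut.mul_apply, hβ _ hx', MulAut.apply_inv_self]

end Automorphisms

namespace FusionSystem

variable {G : Type*} [Group G] {S : Subgroup G} {F : FusionSystem S}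
  {P P' P'' Q R R' R'' T : Subgroup G} {f g : G → G}

theorem IsoOn.mapsTo_sup (hf : F.IsoOn R R' f) {A B V : Subgroup G} (hA : A ≤ R) (hB : B ≤ R)
    (hAV : Set.MapsTo f A V) (hBV : Set.MapsTo f B V) :
    Set.MapsTo f (A ⊔ B : Subgroup G) V := by
  obtain ⟨α, _, h⟩ := hf
  have hmap {X : Subgroup G} (hX : X ≤ R) (hXV : Set.MapsTo f X V) :
      X ≤ ((V.comap R'.subtype).comap α.toMonoidHom).map R.subtype := fun x hx =>
    ⟨⟨x, hX hx⟩, show (α ⟨x, hX hx⟩ : G) ∈ V by rw [h]; exact hXV hx, rfl⟩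
  intro x hx
  obtain ⟨y, hy, rfl⟩ := sup_le (hmap hA hAV) (hmap hB hBV) hx
  have hyV : (α y : G) ∈ V := hy
  rwa [h] at hyV

theorem MorOn.comp (hg : F.MorOn Q g) (hf : F.IsoOn P R f) (hRQ : R ≤ Q) : F.MorOn P (g ∘ f) :=
  let ⟨_, hg⟩ := hg.restrict hRQ
  (hg.comp hf).morOn

/-- The function `f` restricts to an isomorphism of pairs `(R, P) → (R', P')` in `F`, where
`P ≤ R`. -/
structure PairIso (F : FusionSystem S) (R P R' P' : Subgroup G) (f : G → G) : Prop where
  le : P ≤ R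
  isoOn : F.IsoOn R R' f
  isoOn_sub : F.IsoOn P P' f

namespace PairIso

theorem cod_le (h : F.PairIso R P R' P' f) : P' ≤ R' := fun y hy => by
  obtain ⟨x, hx, rfl⟩ := h.isoOn_sub.surjOn hy
  exact h.isoOn.apply_mem (h.le hx)

theorem refl (hP : P ≤ R) (hR : R ≤ S) : F.PairIso R P R P id :=
  ⟨hP, .refl hR, .refl (hP.trans hR)⟩

theorem comp (hg : F.PairIso R' P' R'' P'' g) (hf : F.PairIso R P R' P' f) :
    F.PairIso R P R'' P'' (g ∘ f) :=
  ⟨hf.le, hg.isoOn.comp hf.isoOn, hg.isoOn_sub.comp hf.isoOn_sub⟩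

theorem congr (h : F.PairIso R P R' P' f) (hfg : Set.EqOn g f R) : F.PairIso R P R' P' g :=
  ⟨h.le, h.isoOn.congr hfg, h.isoOn_sub.congr (hfg.mono h.le)⟩

theorem symm (h : F.PairIso R P R' P' f) :
    ∃ g, F.PairIso R' P' R P g ∧ Set.InvOn g f R R' := by
  obtain ⟨g, hg, hgf, hfg⟩ := h.isoOn.symm
  obtain ⟨k, hk, -, hfk⟩ := h.isoOn_sub.symm
  refine ⟨g, ⟨h.cod_le, hg, hk.congr fun y hy => ?_⟩, hgf, hfg⟩
  conv_lhs => rw [← hfk hy]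
  exact hgf (h.le (hk.apply_mem hy))

theorem restrict (h : F.PairIso R P R' P' f) (hPT : P ≤ T) (hTR : T ≤ R) :
    ∃ T' ≤ R', F.PairIso T P T' P' f :=
  let ⟨T', hT', hf⟩ := h.isoOn.restrict hTR
  ⟨T', hT', hPT, hf, h.isoOn_sub⟩

theorem apply_mem_iff (h : F.PairIso R P R' P' f) {x : G} (hx : x ∈ R) : f x ∈ P' ↔ x ∈ P := by
  refine ⟨fun hfx => ?_, h.isoOn_sub.apply_mem⟩
  obtain ⟨y, hy, hxy⟩ := h.isoOn_sub.surjOn hfx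
  rwa [← h.isoOn.injOn (h.le hy) hx hxy]

theorem le_normalizerIn (h : F.PairIso R P R' P' f)
    (hR : R ≤ Subgroup.normalizer (P : Set G)) : R' ≤ normalizerIn S P' := by
  refine le_inf h.isoOn.cod_le (Subgroup.le_normalizer_iff.2 fun y hy z hz => ?_)
  obtain ⟨r, hr, rfl⟩ := h.isoOn.surjOn hy
  obtain ⟨x, hx, rfl⟩ := h.isoOn_sub.surjOn hz
  rw [← h.isoOn.map_conj hr (h.le hx)]
  exact h.isoOn_sub.apply_mem (Subgroup.le_normalizer_iff.1 hR r hr x hx)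

theorem apply_mem_centralizerIn (h : F.PairIso R P R' P' f) {x : G} (hxR : x ∈ R)
    (hx : x ∈ centralizerIn S P) : f x ∈ centralizerIn S P' := by
  refine ⟨h.isoOn.cod_le (h.isoOn.apply_mem hxR), Subgroup.mem_centralizer_iff.2 fun y hy => ?_⟩
  obtain ⟨z, hz, rfl⟩ := h.isoOn_sub.surjOn hy
  rw [← h.isoOn.map_mul (h.le hz) hxR, ← h.isoOn.map_mul hxR (h.le hz),
    Subgroup.mem_centralizer_iff.1 hx.2 z hz]

theorem exists_conj_hom (h : F.PairIso R P R' P' f) {Y : Subgroup G}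
    (hY : Y ≤ normalizerIn S R ⊓ normalizerIn S P) :
    ∃ θ : Y →* MulAut R', (∀ y, θ y ∈ F.autF h.isoOn.cod_le ⊓ autStabilizer R' P') ∧
      ∀ y : Y, ∀ x ∈ R, extendFun (θ y) (f x) = f (y * x * (y : G)⁻¹) := by
  obtain ⟨α, hα, ha⟩ := id h.isoOn
  have hYR : Y ≤ Subgroup.normalizer (R : Set G) := hY.trans (inf_le_left.trans inf_le_right)
  let θ : Y →* MulAut R' := (MulAut.congr α).toMonoidHom.comp
    (R.normalizerMonoidHom.comp (Subgroup.inclusion hYR))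
  have hθ (y : Y) (x : R) : (θ y (α x) : G) = f (y * x * (y : G)⁻¹) :=
    coe_congr_normalizerMonoidHom ha (Subgroup.inclusion hYR y) x
  refine ⟨θ, fun y => ⟨?_, fun x => ?_⟩, fun y x hx => ?_⟩
  · have hy : (R.normalizerMonoidHom (Subgroup.inclusion hYR y)).toMonoidHom ∈ F.Hom R R :=
      F.conj_mem _ h.isoOn.dom_le h.isoOn.dom_le ⟨y, (hY y.2).1.1, fun _ => rfl⟩
    exact F.comp_mem hα (F.comp_mem hy (F.iso_mem_of_comp_mem le_rfl α hα).2)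
  · obtain ⟨z, rfl⟩ := α.surjective x
    have hz := (Subgroup.mem_normalizer_iff.1 (hYR y.2) z).1 z.2
    rw [hθ, h.apply_mem_iff hz, ha, h.apply_mem_iff z.2,
      ← Subgroup.mem_normalizer_iff.1 (hY y.2).2.2 z]
  · rw [← ha ⟨x, hx⟩, extendFun_coe, hθ]

end PairIso

end FusionSystem

section Restriction

variable {G : Type*} [Group G] {Q U : Subgroup G}

/-- The restriction to `Q` of an automorphism of `U` stabilizing `Q`. -/
def restrictAut (hQ : Q ≤ U) : autStabilizer U Q →* MulAut Q where
  toFun α :=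
    { toFun := fun x => ⟨α.1 ⟨x, hQ x.2⟩, (α.2 ⟨x, hQ x.2⟩).2 x.2⟩
      invFun := fun x => ⟨(α⁻¹).1 ⟨x, hQ x.2⟩, ((α⁻¹).2 ⟨x, hQ x.2⟩).2 x.2⟩
      left_inv := fun x => by simp
      right_inv := fun x => by simp
      map_mul' := fun x y => Subtype.ext (congrArg (fun z : U => (z : G))
        (map_mul α.1 ⟨x, hQ x.2⟩ ⟨y, hQ y.2⟩)) }
  map_one' := rfl
  map_mul' _ _ := rfl

theorem mem_autStabilizer_of_restrict (hQ : Q ≤ U) {α : MulAut U} {β : MulAut Q}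
    (h : ∀ x : Q, (α (Subgroup.inclusion hQ x) : G) = β x) : α ∈ autStabilizer U Q := by
  refine fun x => ⟨fun hx => ?_, fun hx => ?_⟩
  · have hβ := h (β⁻¹ ⟨_, hx⟩)
    rw [MulAut.apply_inv_self] at hβ
    rw [← α.injective (Subtype.ext hβ)]
    exact (β⁻¹ _).2
  · rw [show (α x : G) = β ⟨x, hx⟩ from h ⟨x, hx⟩]
    exact (β _).2

theorem inducedAut_eq_map (hQ : Q ≤ U) (D : Subgroup (MulAut U)) :
    inducedAut hQ D = (D.subgroupOf (autStabilizer U Q)).map (restrictAut hQ) := by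
  ext β
  constructor
  · rintro ⟨α, hα, h⟩
    exact ⟨⟨α, mem_autStabilizer_of_restrict hQ h⟩, hα, MulEquiv.ext fun x => Subtype.ext (h x)⟩
  · rintro ⟨α, hα, rfl⟩
    exact ⟨α, hα, fun _ => rfl⟩

theorem inducedAut_relIndex_dvd (hQ : Q ≤ U) (D₀ D : Subgroup (MulAut U)) :
    (inducedAut hQ D₀).relIndex (inducedAut hQ D) ∣ D₀.relIndex (D ⊓ autStabilizer U Q) := by
  rw [inducedAut_eq_map, inducedAut_eq_map, ← Subgroup.inf_subgroupOf_right D,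
    ← Subgroup.relIndex_subgroupOf (inf_le_right : D ⊓ autStabilizer U Q ≤ autStabilizer U Q)]
  exact relIndex_map_map_dvd _ _ _

theorem inducedAut_autConj_le {S : Subgroup G} (hQ : Q ≤ U) :
    inducedAut hQ (autConj S U) ≤ autConj S Q := by
  rintro β ⟨α, ⟨t, ht, h⟩, hβ⟩
  exact ⟨t, ht, fun x => by rw [← hβ, h, Subgroup.coe_inclusion]⟩

end Restriction

namespace FusionSystem

variable {G : Type*} [Group G] {S : Subgroup G} {F : FusionSystem S} {p : ℕ}
  {R Q R' Q' Y : Subgroup G} {f : G → G}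

theorem pairIso_of_mem_autStabilizer (hQ : Q ≤ R) {hR : R ≤ S} {α : MulAut R}
    (hα : α ∈ F.autF hR ⊓ autStabilizer R Q) : F.PairIso R Q R Q (extendFun α) := by
  obtain ⟨hαF, hαQ⟩ : α ∈ F.autF hR ∧ α ∈ autStabilizer R Q := hα
  refine ⟨hQ, mem_autF_iff.1 hαF, (mem_autF_iff.1 hαF).restrict_of_image_eq hQ ?_⟩
  refine subset_antisymm (Set.image_subset_iff.2 fun x hx => ?_) fun x hx => ?_
  · rw [Set.mem_preimage, extendFun_of_mem _ (hQ hx)]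
    exact (hαQ _).2 hx
  · refine ⟨(α⁻¹ ⟨x, hQ hx⟩ : R), (inv_mem hαQ _).2 hx, ?_⟩
    rw [extendFun_coe, MulAut.apply_inv_self]

theorem inducedAut_autF_le (hQR : Q ≤ R) (hR : R ≤ S) :
    inducedAut hQR (F.autF hR) ≤ F.autF (hQR.trans hR) := by
  rintro β ⟨α, hα, h⟩
  refine mem_autF_iff.2 ((pairIso_of_mem_autStabilizer hQR
    ⟨hα, mem_autStabilizer_of_restrict hQR h⟩).isoOn_sub.congr fun x hx => ?_)
  rw [extendFun_of_mem β hx, extendFun_of_mem α (hQR hx), ← h]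
  rfl

/-- The subgroup `R` is receptive, and `Aut_S(R)` contains a Sylow `p`-subgroup of the stabilizer of
its subgroup `Q` in `Aut_F(R)`. -/
structure SylowReceptive (F : FusionSystem S) (p : ℕ) {R : Subgroup G} (hR : R ≤ S)
    (Q : Subgroup G) : Prop where
  le : Q ≤ R
  receptive : F.Receptive R
  not_dvd : ¬ p ∣ (autConj S R).relIndex (F.autF hR ⊓ autStabilizer R Q)

theorem exists_sylowReceptive [Fact p.Prime] [Finite S] (hS : IsPGroup p S)
    (h : F.SaturatedAt p R) (hQ : Q ≤ R) :
    ∃ R₁ Q₁, ∃ hR₁ : R₁ ≤ S, ∃ f, F.PairIso R Q R₁ Q₁ f ∧ F.SylowReceptive p hR₁ Q₁ := by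
  obtain ⟨R₁, hR₁, f, hf, ha, hr⟩ := h
  have : Finite R₁ := Finite.of_injective _ (Subgroup.inclusion_injective hR₁)
  obtain ⟨Q₁, hQ₁, hfQ⟩ := hf.restrict hQ
  obtain ⟨h, hh, hi⟩ := exists_not_dvd_relIndex_map_conj (autConj_le_autF hR₁)
    (isPGroup_autConj hS) ha (inf_le_left : F.autF hR₁ ⊓ autStabilizer R₁ Q₁ ≤ F.autF hR₁)
  have hhR := mem_autF_iff.1 hh
  obtain ⟨Q₂, hQ₂, hhQ⟩ := hhR.restrict hQ₁
  refine ⟨R₁, Q₂, hR₁, _, ⟨hQ, hhR.comp hf, hhQ.comp hfQ⟩, hQ₂, hr, ?_⟩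
  have hmem (x : R₁) : (h x : G) ∈ Q₂ ↔ (x : G) ∈ Q₁ := by
    rw [← (PairIso.mk hQ₁ hhR hhQ).apply_mem_iff x.2, extendFun_coe]
  convert hi using 3
  ext ν
  rw [Subgroup.mem_map_equiv, Subgroup.mem_inf, Subgroup.mem_inf,
    show (MulAut.conj h).symm ν = h⁻¹ * ν * h by simp, Subgroup.mul_mem_cancel_right _ hh,
    Subgroup.mul_mem_cancel_left _ (inv_mem hh)]
  refine and_congr_right fun _ => ⟨fun hν x => ?_, fun hν x => ?_⟩
  · rw [← hmem, MulAut.mul_apply, MulAut.mul_apply, MulAut.apply_inv_self, hν, hmem]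
  · have hx := hν (h⁻¹ x)
    rwa [MulAut.mul_apply, MulAut.apply_inv_self, MulAut.mul_apply, ← hmem, ← hmem,
      MulAut.apply_inv_self, MulAut.apply_inv_self] at hx

namespace SylowReceptive

variable [Fact p.Prime] [Finite S] {hR : R ≤ S}

theorem exists_extension (hS : IsPGroup p S) (h : F.SylowReceptive p hR Q)
    {N : Subgroup (MulAut R)} (hN : N ≤ F.autF hR ⊓ autStabilizer R Q)
    (hNn : F.autF hR ⊓ autStabilizer R Q ≤ Subgroup.normalizer (N : Set (MulAut R)))
    (hf : F.PairIso R' Q' R Q f) (hY : Y ≤ normalizerIn S R' ⊓ normalizerIn S Q')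
    (hYN : ∀ y ∈ Y, ∀ β ∈ F.autF hR ⊓ autStabilizer R Q,
      (∀ x ∈ R', extendFun β (f x) = f (y * x * y⁻¹)) →
      β ∈ N ⊔ (autConj S R ⊓ (F.autF hR ⊓ autStabilizer R Q))) :
    ∃ ν ∈ N, ∃ f', F.MorOn (R' ⊔ Y) f' ∧ Set.EqOn f' (extendFun ν ∘ f) R' := by
  have : Finite R := Finite.of_injective _ (Subgroup.inclusion_injective hR)
  obtain ⟨θ, hθA, hθ⟩ := hf.exists_conj_hom hY
  have hθp : IsPGroup p θ.range :=
    (hS.to_le (hY.trans (inf_le_left.trans inf_le_left))).of_surjective _ θ.rangeRestrict_surjective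
  have hi : ¬ p ∣ (autConj S R ⊓ (F.autF hR ⊓ autStabilizer R Q)).relIndex
      (N ⊔ (autConj S R ⊓ (F.autF hR ⊓ autStabilizer R Q))) := fun hd => by
    have hmul := Subgroup.relIndex_mul_relIndex _ _ _
      (le_sup_right : autConj S R ⊓ (F.autF hR ⊓ autStabilizer R Q) ≤ N ⊔ _)
      (sup_le hN inf_le_right)
    rw [Subgroup.inf_relIndex_right] at hmul
    exact h.not_dvd (hmul ▸ hd.mul_right _)
  obtain ⟨ν, hν, hνθ⟩ := exists_map_conj_le_of_le_sup ((isPGroup_autConj hS).to_le inf_le_left)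
    (inf_le_right.trans hNn) hi hθp (by
      rintro _ ⟨y, rfl⟩
      exact hYN y y.2 (θ y) (hθA y) (hθ y))
  have hνf := (mem_autF_iff.1 (hN hν).1).comp hf.isoOn
  obtain ⟨f', hf', hf'ν⟩ := h.receptive hνf (hY.trans inf_le_left) fun y hy => by
    obtain ⟨⟨t, ht, htν⟩, -⟩ := hνθ ⟨θ ⟨y, hy⟩, ⟨_, rfl⟩, rfl⟩
    refine ⟨t, ht, fun x hx => ?_⟩
    have hfx := hf.isoOn.apply_mem hx
    have hνx := htν (ν ⟨f x, hfx⟩)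
    rw [Function.comp_apply, Function.comp_apply, ← hθ ⟨y, hy⟩ x hx, extendFun_of_mem _ hfx,
      extendFun_of_mem _ hfx, extendFun_coe, ← hνx]
    simp
  exact ⟨ν, hν, f', hf', hf'ν⟩

theorem exists_extension_normalizer (hS : IsPGroup p S) (h : F.SylowReceptive p hR Q)
    (hf : F.PairIso R' Q' R Q f) :
    ∃ f' M, F.PairIso (normalizerIn S R' ⊓ normalizerIn S Q') Q' M Q f' := by
  obtain ⟨ν, hν, f', hf', hfν⟩ := h.exists_extension hS le_rfl Subgroup.le_normalizer hf le_rfl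
    fun _ _ _ hβ _ => Subgroup.mem_sup_left hβ
  have hQ' := hf.le.trans (_root_.le_normalizerIn hf.isoOn.dom_le)
  obtain ⟨M, hM⟩ := hf'.restrict le_sup_right
  exact ⟨f', M, le_inf hQ' (_root_.le_normalizerIn hf.isoOn_sub.dom_le), hM,
    (((pairIso_of_mem_autStabilizer h.le hν).comp hf).congr hfν).isoOn_sub⟩

theorem exists_extension_eqOn (hS : IsPGroup p S) (h : F.SylowReceptive p hR Q)
    (hf : F.PairIso R' Q' R Q f) (hY : Y ≤ normalizerIn S R' ⊓ normalizerIn S Q')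
    (hYf : ∀ y ∈ Y, ∃ t ∈ normalizerIn S R, ∀ x ∈ Q', f (y * x * y⁻¹) = t * f x * t⁻¹) :
    ∃ f', F.MorOn (R' ⊔ Y) f' ∧ F.PairIso R' Q' R Q f' ∧ Set.EqOn f' f Q' := by
  have hYN : ∀ y ∈ Y, ∀ β ∈ F.autF hR ⊓ autStabilizer R Q,
      (∀ x ∈ R', extendFun β (f x) = f (y * x * y⁻¹)) →
      β ∈ (F.autF hR ⊓ autStabilizer R Q) ⊓ autFixing R Q ⊔
        (autConj S R ⊓ (F.autF hR ⊓ autStabilizer R Q)) := by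
    intro y hy β hβ hβf
    obtain ⟨t, ht, htf⟩ := hYf y hy
    let γ : MulAut R := R.normalizerMonoidHom ⟨t, ht.2⟩
    have hγ : γ ∈ autConj S R := ⟨t, ht.1, fun _ => rfl⟩
    have hfix : γ⁻¹ * β ∈ autFixing R Q := fun x hx => by
      obtain ⟨z, hz, hzx⟩ := hf.isoOn_sub.surjOn hx
      rw [MulAut.mul_apply, MulAut.inv_apply, MulEquiv.symm_apply_eq]
      refine Subtype.ext ?_
      rw [← extendFun_coe β x, ← hzx, hβf z (hf.le hz), htf z hz, hzx]
      rfl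
    have hγA : γ ∈ F.autF hR ⊓ autStabilizer R Q := by
      refine ⟨autConj_le_autF hR hγ, ?_⟩
      simpa using Subgroup.mul_mem _ hβ.2 (Subgroup.inv_mem _ (autFixing_le_autStabilizer hfix))
    rw [← mul_inv_cancel_left γ β]
    exact mul_mem (Subgroup.mem_sup_right ⟨hγ, hγA⟩)
      (Subgroup.mem_sup_left ⟨Subgroup.mul_mem _ (Subgroup.inv_mem _ hγA) hβ, hfix⟩)
  obtain ⟨ν, ⟨hν, hνQ⟩, f', hf', hfν⟩ := h.exists_extension hS inf_le_left
    (fun β hβ => Subgroup.inf_normalizer_le_normalizer_inf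
      ⟨Subgroup.le_normalizer hβ, autStabilizer_le_normalizer_autFixing hβ.2⟩) hf hY hYN
  refine ⟨f', hf', ((pairIso_of_mem_autStabilizer h.le hν).comp hf).congr hfν, fun x hx => ?_⟩
  have hx' := hf.isoOn_sub.apply_mem hx
  rw [hfν (hf.le hx), Function.comp_apply, extendFun_of_mem _ (h.le hx'), hνQ _ hx']

end SylowReceptive

end FusionSystem

namespace FusionSystem

variable {G : Type*} [Group G] {S : Subgroup G} {F : FusionSystem S} {p : ℕ}
  {P P₀ Q R R₀ : Subgroup G} {f : G → G}

/-- Some isomorphism `P → Q` in `F` extends to `N_S(P)`; its extension then maps into `N_S(Q)`. -/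
def NormalizerArrow (F : FusionSystem S) (P Q : Subgroup G) : Prop :=
  ∃ f M, F.PairIso (normalizerIn S P) P M Q f

namespace NormalizerArrow

theorem refl (hP : P ≤ S) : F.NormalizerArrow P P :=
  ⟨id, _, .refl (le_normalizerIn hP) inf_le_left⟩

theorem trans (h₁ : F.NormalizerArrow P Q) (h₂ : F.NormalizerArrow Q R) :
    F.NormalizerArrow P R := by
  obtain ⟨f, M, hf⟩ := h₁
  obtain ⟨g, N, hg⟩ := h₂
  obtain ⟨M', _, hg'⟩ := hg.restrict hf.cod_le (hf.le_normalizerIn inf_le_right)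
  exact ⟨g ∘ f, M', hg'.comp hf⟩

theorem symm_of_card_le [Finite S] (h : F.NormalizerArrow P Q)
    (hc : Nat.card (normalizerIn S Q) ≤ Nat.card (normalizerIn S P)) : F.NormalizerArrow Q P := by
  obtain ⟨f, M, hf⟩ := h
  obtain rfl : M = normalizerIn S Q := eq_of_le_of_card_le inf_le_left
    (hf.le_normalizerIn inf_le_right) (by rwa [← hf.isoOn.card_eq])
  obtain ⟨g, hg, -⟩ := hf.symm
  exact ⟨g, _, hg⟩

end NormalizerArrow

/-- Any two subgroups `P` and `P'` which correspond to each other under an isomorphism between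
subgroups of order greater than `m` normalizing them have normalizer arrows to a common target. -/
def JoinsAbove (F : FusionSystem S) (m : ℕ) : Prop :=
  ∀ ⦃R P R' P' : Subgroup G⦄ ⦃f : G → G⦄, F.PairIso R P R' P' f →
    R ≤ Subgroup.normalizer (P : Set G) → m < Nat.card R → Relation.Join F.NormalizerArrow P P'

theorem NormalizerArrow.join {m : ℕ} (h : F.JoinsAbove m) (hP : m < Nat.card (normalizerIn S P))
    (h₁ : F.NormalizerArrow P Q) (h₂ : F.NormalizerArrow P R) :
    Relation.Join F.NormalizerArrow Q R := by
  obtain ⟨a, A, ha⟩ := h₁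
  obtain ⟨b, B, hb⟩ := h₂
  obtain ⟨a', ha', -⟩ := ha.symm
  exact h (hb.comp ha') ((ha.le_normalizerIn inf_le_right).trans inf_le_right)
    (ha.isoOn.card_eq ▸ hP)

theorem join_trans {m : ℕ} (h : F.JoinsAbove m) (hQ : m < Nat.card (normalizerIn S Q))
    (h₁ : Relation.Join F.NormalizerArrow P Q) (h₂ : Relation.Join F.NormalizerArrow Q R) :
    Relation.Join F.NormalizerArrow P R := by
  obtain ⟨A, hPA, hQA⟩ := h₁
  obtain ⟨B, hQB, hRB⟩ := h₂
  obtain ⟨C, hAC, hBC⟩ := hQA.join h hQ hQB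
  exact ⟨C, hPA.trans hAC, hRB.trans hBC⟩

/-- On `P`, the function `f` is a composite of finitely many maps `g : Q → R` with `r Q R g`. -/
inductive CompositeOf (r : Subgroup G → Subgroup G → (G → G) → Prop) (P : Subgroup G) :
    Subgroup G → (G → G) → Prop
  | refl {f : G → G} (hf : Set.EqOn f id P) : CompositeOf r P P f
  | step {Q R : Subgroup G} {f g h : G → G} (hf : CompositeOf r P Q f) (hg : r Q R g)
      (hh : Set.EqOn h (g ∘ f) P) : CompositeOf r P R h

theorem CompositeOf.isoOn {r : Subgroup G → Subgroup G → (G → G) → Prop}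
    (hr : ∀ Q R g, r Q R g → F.IsoOn Q R g) (hP : P ≤ S) (h : CompositeOf r P Q f) :
    F.IsoOn P Q f := by
  induction h with
  | refl hf => exact (IsoOn.refl hP).congr hf
  | step _ hg hh ih => exact ((hr _ _ _ hg).comp ih).congr hh

/-- The function `f` restricts to an isomorphism `P → Q` in `F` which extends to a subgroup
properly containing `P`. -/
def ExtendsToLarger (F : FusionSystem S) (P Q : Subgroup G) (f : G → G) : Prop :=
  ∃ X X', P < X ∧ F.PairIso X P X' Q f

theorem ExtendsToLarger.isoOn (h : F.ExtendsToLarger P Q f) : F.IsoOn P Q f :=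
  let ⟨_, _, _, h⟩ := h
  h.isoOn_sub

variable [Fact p.Prime] [Finite S]

theorem eq_normalizerIn_of_inf_eq (hS : IsPGroup p S) (hRS : R ≤ S)
    (hR : R ≤ Subgroup.normalizer (P : Set G))
    (h : normalizerIn S R ⊓ normalizerIn S P = R) : normalizerIn S P = R := by
  by_contra hne
  obtain ⟨g, hg, hn, hgR⟩ := exists_mem_normalizerIn_notMem hS inf_le_left
    (lt_of_le_of_ne (le_inf hRS hR) (Ne.symm hne))
  exact hgR (h ▸ ⟨hn, hg⟩)

theorem SylowReceptive.arrow_or_join (hS : IsPGroup p S) {hR₀ : R₀ ≤ S}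
    (h : F.SylowReceptive p hR₀ P₀) (hJ : F.JoinsAbove (Nat.card R₀))
    (hf : F.PairIso R P R₀ P₀ f) (hR : R ≤ Subgroup.normalizer (P : Set G)) :
    F.NormalizerArrow P P₀ ∨
      Nat.card R₀ < Nat.card (normalizerIn S P₀) ∧ Relation.Join F.NormalizerArrow P P₀ := by
  obtain ⟨a, M, ha⟩ := h.exists_extension_normalizer hS hf
  by_cases hRP : normalizerIn S R ⊓ normalizerIn S P = R
  · left
    rw [hRP, ← eq_normalizerIn_of_inf_eq hS hf.isoOn.dom_le hR hRP] at ha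
    exact ⟨a, M, ha⟩
  · right
    have hlt := card_lt_of_lt_of_le ha.isoOn.dom_le (lt_of_le_of_ne
      (le_inf (le_normalizerIn hf.isoOn.dom_le) (le_inf hf.isoOn.dom_le hR)) (Ne.symm hRP))
    rw [hf.isoOn.card_eq] at hlt
    have hM := ha.le_normalizerIn (inf_le_right.trans inf_le_right)
    exact ⟨(hlt.trans_eq ha.isoOn.card_eq).trans_le (card_le_of_le_of_le inf_le_left hM),
      hJ ha (inf_le_right.trans inf_le_right) hlt⟩

theorem joinsAbove (hS : IsPGroup p S) {n : ℕ}
    (hsat : ∀ R ≤ S, n < Nat.card R → F.SaturatedAt p R) : F.JoinsAbove n := by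
  intro R P R' P' f hf hR hn
  induction hk : Nat.card S - Nat.card R using Nat.strong_induction_on
    generalizing R P R' P' f with
  | _ k ih =>
  obtain ⟨R₀, P₀, hR₀, g, hg, h₀⟩ := exists_sylowReceptive hS (hsat R hf.isoOn.dom_le hn) hf.le
  have hJ : F.JoinsAbove (Nat.card R₀) := fun X _ _ _ _ ha hX hlt => by
    rw [← hg.isoOn.card_eq] at hlt
    have hle := card_le_of_le_of_le le_rfl ha.isoOn.dom_le
    exact ih _ (by omega) ha hX (hn.trans hlt) rfl
  obtain ⟨f', hf', -⟩ := hf.symm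
  have h := h₀.arrow_or_join hS hJ hg hR
  have h' := h₀.arrow_or_join hS hJ (hg.comp hf') ((hf.le_normalizerIn hR).trans inf_le_right)
  have hrefl : F.NormalizerArrow P₀ P₀ := .refl hg.isoOn_sub.cod_le
  by_cases hc : Nat.card R₀ < Nat.card (normalizerIn S P₀)
  · exact join_trans hJ hc (h.elim (fun h => ⟨P₀, h, hrefl⟩) And.right)
      (symm (h'.elim (fun h => ⟨P₀, h, hrefl⟩) And.right))
  · exact ⟨P₀, h.resolve_right fun h => hc h.1, h'.resolve_right fun h => hc h.1⟩

theorem ExtendsToLarger.exists_le_normalizerIn (hS : IsPGroup p S)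
    (h : F.ExtendsToLarger P Q f) :
    ∃ X X', P < X ∧ X ≤ normalizerIn S P ∧ F.PairIso X P X' Q f := by
  obtain ⟨X, X', hPX, hf⟩ := h
  obtain ⟨y, hy, hn, hyP⟩ := exists_mem_normalizerIn_notMem hS hf.isoOn.dom_le hPX
  have hlt : P < X ⊓ normalizerIn S P := SetLike.lt_iff_le_and_exists.2
    ⟨le_inf hPX.le (le_normalizerIn hf.isoOn_sub.dom_le), y, Subgroup.mem_inf.2 ⟨hy, hn⟩, hyP⟩
  obtain ⟨Z, -, hZ⟩ := hf.restrict hlt.le inf_le_left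
  exact ⟨_, Z, hlt, inf_le_right, hZ⟩

theorem CompositeOf.join (hS : IsPGroup p S)
    (hsat : ∀ R ≤ S, Nat.card P < Nat.card R → F.SaturatedAt p R) (hP : P ≤ S)
    (h : CompositeOf F.ExtendsToLarger P Q f) : Relation.Join F.NormalizerArrow P Q := by
  induction h with
  | refl => exact ⟨P, .refl hP, .refl hP⟩
  | step hf hg _ ih =>
    obtain ⟨X, X', hlt, hX, hX'⟩ := hg.exists_le_normalizerIn hS
    have hc := card_lt_of_lt_of_le hX'.isoOn.dom_le hlt
    rw [← (hf.isoOn (fun _ _ _ h => h.isoOn) hP).card_eq] at hc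
    have hJ := joinsAbove hS hsat
    exact join_trans hJ (hc.trans_le (card_le_of_le_of_le inf_le_left hX)) ih
      (hJ hX' (hX.trans inf_le_right) hc)

theorem exists_normalizerArrow_target (hS : IsPGroup p S) (hP : P ≤ S)
    (hsat : ∀ R ≤ S, Nat.card P < Nat.card R → F.SaturatedAt p R)
    (hgen : ∀ A B f g, F.IsoOn P A f → F.IsoOn A B g → CompositeOf F.ExtendsToLarger A B g) :
    ∃ Q f, F.IsoOn P Q f ∧ ∀ A g, F.IsoOn P A g → F.NormalizerArrow A Q := by
  let N : Set ℕ := {m | ∃ Q f, F.IsoOn P Q f ∧ Nat.card (normalizerIn S Q) = m}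
  have hb : BddAbove N := ⟨Nat.card S, by
    rintro m ⟨Q, f, -, rfl⟩
    exact card_le_of_le_of_le le_rfl inf_le_left⟩
  obtain ⟨Q, f, hf, hQ⟩ := Nat.sSup_mem (s := N) ⟨_, P, id, IsoOn.refl hP, rfl⟩ hb
  refine ⟨Q, f, hf, fun A g hg => ?_⟩
  obtain ⟨f', hf', -⟩ := hf.symm
  obtain ⟨C, hQC, hAC⟩ := (hgen Q A f _ hf (hg.comp hf')).join hS
    (by rwa [← hf.card_eq]) hf.cod_le
  refine hAC.trans (hQC.symm_of_card_le ?_)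
  obtain ⟨c, M, hc⟩ := hQC
  exact (le_csSup hb ⟨C, _, hc.isoOn_sub.comp hf, rfl⟩).trans_eq hQ.symm

end FusionSystem

section Centralizers

variable {G : Type*} [Group G] {S Q R : Subgroup G}

theorem sup_centralizerIn_le_normalizerIn (hQ : Q ≤ S) :
    Q ⊔ centralizerIn S Q ≤ normalizerIn S Q :=
  sup_le (le_normalizerIn hQ) centralizerIn_le_normalizerIn

theorem normalizer_le_normalizer_centralizer :
    Subgroup.normalizer (Q : Set G) ≤
      Subgroup.normalizer (Subgroup.centralizer (Q : Set G) : Set G) := by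
  refine Subgroup.le_normalizer_iff.2 fun g hg c hc => Subgroup.mem_centralizer_iff.2 fun y hy => ?_
  have hy' : g⁻¹ * y * g ∈ Q := (Subgroup.mem_normalizer_iff''.1 hg y).1 hy
  calc y * (g * c * g⁻¹) = g * ((g⁻¹ * y * g) * c) * g⁻¹ := by group
    _ = g * (c * (g⁻¹ * y * g)) * g⁻¹ := by rw [Subgroup.mem_centralizer_iff.1 hc _ hy']
    _ = g * c * g⁻¹ * y := by group

theorem normalizerIn_le_normalizer_centralizerIn :
    normalizerIn S Q ≤ Subgroup.normalizer (centralizerIn S Q : Set G) :=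
  (inf_le_inf Subgroup.le_normalizer normalizer_le_normalizer_centralizer).trans
    Subgroup.inf_normalizer_le_normalizer_inf

theorem normalizerIn_le_normalizer_sup_centralizerIn :
    normalizerIn S Q ≤ Subgroup.normalizer ((Q ⊔ centralizerIn S Q : Subgroup G) : Set G) :=
  (le_inf inf_le_right normalizerIn_le_normalizer_centralizerIn).trans
    (Subgroup.normalizer_inf_normalizer_le_normalizer_sup _ _)

open scoped Pointwise in
theorem exists_mem_centralizerIn_normalizer_notMem {p : ℕ} [Fact p.Prime] [Finite S]
    (hS : IsPGroup p S) (hR : R ≤ normalizerIn S Q) (hC : ¬ centralizerIn S Q ≤ R) :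
    ∃ c ∈ centralizerIn S Q, c ∈ Subgroup.normalizer (R : Set G) ∧ c ∉ R := by
  obtain ⟨x, hx, hn, hxR⟩ := exists_mem_normalizerIn_notMem hS
    (sup_le (hR.trans inf_le_left) inf_le_left : R ⊔ centralizerIn S Q ≤ S)
    (left_lt_sup.2 hC)
  have hmul := Subgroup.coe_mul_of_left_le_normalizer_right R (centralizerIn S Q)
    (hR.trans normalizerIn_le_normalizer_centralizerIn)
  obtain ⟨r, hr, c, hc, rfl⟩ : x ∈ (R : Set G) * (centralizerIn S Q : Set G) := hmul ▸ hx
  refine ⟨c, hc, ?_, fun hcR => hxR (R.mul_mem hr hcR)⟩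
  exact (Subgroup.mul_mem_cancel_left _ (Subgroup.le_normalizer hr)).1 hn.2

end Centralizers

namespace FusionSystem

variable {G : Type*} [Group G] {S : Subgroup G} {F : FusionSystem S} {p : ℕ}
  {P Q Q₀ R R₀ R' Q' T M : Subgroup G} {f g : G → G}

namespace PairIso

theorem mapsTo_sup_centralizerIn (h : F.PairIso R Q R' Q' f) (hC : centralizerIn S Q ≤ R) :
    Set.MapsTo f (Q ⊔ centralizerIn S Q : Subgroup G) (Q' ⊔ centralizerIn S Q' : Subgroup G) :=
  h.isoOn.mapsTo_sup h.le hC (fun _ hx => Subgroup.mem_sup_left (h.isoOn_sub.apply_mem hx))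
    fun _ hx => Subgroup.mem_sup_right (h.apply_mem_centralizerIn (hC hx) hx)

variable [Finite S]

theorem card_sup_centralizerIn_le (h : F.PairIso R Q R' Q' f) (hC : centralizerIn S Q ≤ R) :
    Nat.card (Q ⊔ centralizerIn S Q : Subgroup G) ≤
      Nat.card (Q' ⊔ centralizerIn S Q' : Subgroup G) := by
  obtain ⟨Z, -, hZ⟩ := h.restrict le_sup_left (sup_le h.le hC)
  rw [hZ.isoOn.card_eq]
  refine card_le_of_le_of_le (sup_le h.isoOn_sub.cod_le inf_le_left) ?_
  rw [← SetLike.coe_subset_coe, ← hZ.isoOn.image_eq]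
  exact (h.mapsTo_sup_centralizerIn hC).image_subset

theorem restrict_sup_centralizerIn (h : F.PairIso R Q R' Q' f) (hC : centralizerIn S Q ≤ R)
    (hcard : Nat.card (Q' ⊔ centralizerIn S Q' : Subgroup G) ≤
      Nat.card (Q ⊔ centralizerIn S Q : Subgroup G)) :
    F.PairIso (Q ⊔ centralizerIn S Q) Q (Q' ⊔ centralizerIn S Q') Q' f := by
  obtain ⟨Z, -, hZ⟩ := h.restrict le_sup_left (sup_le h.le hC)
  have hle : Z ≤ Q' ⊔ centralizerIn S Q' := by
    rw [← SetLike.coe_subset_coe, ← hZ.isoOn.image_eq]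
    exact (h.mapsTo_sup_centralizerIn hC).image_subset
  have hZe : Z = Q' ⊔ centralizerIn S Q' :=
    eq_of_le_of_card_le (sup_le h.isoOn_sub.cod_le inf_le_left) hle (hZ.isoOn.card_eq ▸ hcard)
  rwa [hZe] at hZ

end PairIso

/-- The restriction of `f` to `Q` extends to an automorphism of `Q C_S(Q)` in `F`. -/
def ExtendsToCentralizer (F : FusionSystem S) (Q : Subgroup G) (f : G → G) : Prop :=
  ∃ f', F.IsoOn (Q ⊔ centralizerIn S Q) (Q ⊔ centralizerIn S Q) f' ∧ Set.EqOn f' f Q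

theorem PairIso.extendsToCentralizer [Finite S] (h : F.PairIso R Q R' Q f)
    (hC : centralizerIn S Q ≤ R) : F.ExtendsToCentralizer Q f :=
  ⟨f, (h.restrict_sup_centralizerIn hC le_rfl).isoOn, Set.eqOn_refl _ _⟩

namespace ExtendsToCentralizer

theorem congr (h : F.ExtendsToCentralizer Q f) (hfg : Set.EqOn g f Q) :
    F.ExtendsToCentralizer Q g :=
  let ⟨f', hf', h⟩ := h
  ⟨f', hf', h.trans hfg.symm⟩

theorem comp (hg : F.ExtendsToCentralizer Q g) (hf : F.ExtendsToCentralizer Q f)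
    (hfQ : Set.MapsTo f Q Q) : F.ExtendsToCentralizer Q (g ∘ f) := by
  obtain ⟨f', hf', h⟩ := hf
  obtain ⟨g', hg', h'⟩ := hg
  refine ⟨_, hg'.comp hf', fun x hx => ?_⟩
  rw [Function.comp_apply, h hx, h' (hfQ hx), Function.comp_apply]

theorem of_comp (hg : F.ExtendsToCentralizer Q g) (hfQ : Set.MapsTo f Q Q)
    (hgf : F.ExtendsToCentralizer Q (g ∘ f)) : F.ExtendsToCentralizer Q f := by
  obtain ⟨k, hk, h⟩ := hgf
  obtain ⟨g', hg', h'⟩ := hg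
  obtain ⟨i, hi, hig, -⟩ := hg'.symm
  refine ⟨_, hi.comp hk, fun x hx => ?_⟩
  rw [Function.comp_apply, h hx, Function.comp_apply, ← h' (hfQ hx),
    hig (Subgroup.mem_sup_left (hfQ hx))]

end ExtendsToCentralizer

theorem SylowReceptive.automized {hR : R ≤ S} (h : F.SylowReceptive p hR Q)
    (hext : F.autF (h.le.trans hR) ≤ inducedAut h.le (F.autF hR)) :
    F.Automized p (h.le.trans hR) := by
  rw [Automized, le_antisymm hext (inducedAut_autF_le h.le hR)]
  exact fun hd => h.not_dvd (hd.trans ((Subgroup.relIndex_dvd_of_le_left _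
    (inducedAut_autConj_le h.le)).trans (inducedAut_relIndex_dvd h.le _ _)))

variable [Fact p.Prime] [Finite S]

theorem SylowReceptive.extendsToCentralizer_comp (hS : IsPGroup p S) {hR₀ : R₀ ≤ S}
    (h : F.SylowReceptive p hR₀ Q₀) (hg : F.PairIso (normalizerIn S Q₀) Q₀ M Q g)
    (hf : F.PairIso T Q R₀ Q₀ f) (hT : T ≤ normalizerIn S Q)
    (hlarge : ∀ (X X' : Subgroup G) (k : G → G), Nat.card T < Nat.card X →
      X ≤ normalizerIn S Q → F.PairIso X Q X' Q k → F.ExtendsToCentralizer Q k) :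
    F.ExtendsToCentralizer Q (g ∘ f) := by
  by_cases hC : centralizerIn S Q ≤ T
  · obtain ⟨M', -, hM'⟩ := hg.restrict hf.cod_le (hf.le_normalizerIn (hT.trans inf_le_right))
    exact (hM'.comp hf).extendsToCentralizer hC
  · obtain ⟨c, hc, hcT, hcn⟩ := exists_mem_centralizerIn_normalizer_notMem hS hT hC
    have hY : centralizerIn S Q ⊓ Subgroup.normalizer (T : Set G) ≤
        normalizerIn S T ⊓ normalizerIn S Q :=
      le_inf (inf_le_inf_right _ inf_le_left) (inf_le_left.trans centralizerIn_le_normalizerIn)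
    obtain ⟨f', ⟨V, hV⟩, hf', hff'⟩ := h.exists_extension_eqOn hS hf hY fun y hy =>
      ⟨1, Subgroup.one_mem _, fun x hx => by
        rw [← Subgroup.mem_centralizer_iff.1 hy.1.2 x hx]
        simp⟩
    have hX : T ⊔ centralizerIn S Q ⊓ Subgroup.normalizer (T : Set G) ≤ normalizerIn S Q :=
      sup_le hT (hY.trans inf_le_right)
    have hV' : F.PairIso _ Q V Q₀ f' := ⟨hf.le.trans le_sup_left, hV, hf'.isoOn_sub⟩
    obtain ⟨M', -, hM'⟩ := hg.restrict hV'.cod_le (hV'.le_normalizerIn (hX.trans inf_le_right))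
    refine (hlarge _ _ _ (card_lt_of_lt_of_le hV.dom_le (left_lt_sup.2 fun hle => ?_)) hX
      (hM'.comp hV')).congr fun x hx => ?_
    · exact hcn (hle ⟨hc, hcT⟩)
    · rw [Function.comp_apply, Function.comp_apply, hff' hx]

theorem PairIso.extendsToCentralizer_of_saturatedAt (hS : IsPGroup p S) {n : ℕ}
    (hsat : ∀ R ≤ S, n < Nat.card R → F.SaturatedAt p R)
    (htop : ∀ P f, F.IsoOn Q P f → F.NormalizerArrow P Q) (hn : n < Nat.card R)
    (hR : R ≤ normalizerIn S Q) (hf : F.PairIso R Q R' Q f) : F.ExtendsToCentralizer Q f := by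
  induction hm : Nat.card S - Nat.card R using Nat.strong_induction_on
    generalizing R R' f with
  | _ m ih =>
  obtain ⟨R₀, Q₀, hR₀, g, hg, h₀⟩ := exists_sylowReceptive hS (hsat R hf.isoOn.dom_le hn) hf.le
  obtain ⟨ψ, M, hψ⟩ := htop _ _ hg.isoOn_sub
  have hlarge {T : Subgroup G} (hT : Nat.card T = Nat.card R) (X X' : Subgroup G) (k : G → G)
      (hTX : Nat.card T < Nat.card X) (hX : X ≤ normalizerIn S Q) (hk : F.PairIso X Q X' Q k) :
      F.ExtendsToCentralizer Q k := by
    have hle := card_le_of_le_of_le le_rfl hk.isoOn.dom_le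
    exact ih _ (by omega) (by omega) hX hk rfl
  obtain ⟨f', hf', hff', -⟩ := hf.symm
  have h₁ := h₀.extendsToCentralizer_comp hS hψ hg hR (hlarge rfl)
  have h₂ := h₀.extendsToCentralizer_comp hS hψ (hg.comp hf')
    (hf.le_normalizerIn (hR.trans inf_le_right)) (hlarge hf.isoOn.card_eq.symm)
  refine h₂.of_comp (fun _ => hf.isoOn_sub.apply_mem) (h₁.congr fun x hx => ?_)
  simp only [Function.comp_apply, hff' (hf.le hx)]

theorem CompositeOf.extendsToCentralizer (hS : IsPGroup p S) (hQ : Q ≤ S)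
    (hsat : ∀ R ≤ S, Nat.card Q < Nat.card R → F.SaturatedAt p R)
    (htop : ∀ P f, F.IsoOn Q P f → F.NormalizerArrow P Q)
    (h : CompositeOf F.ExtendsToLarger Q P f) (hg : F.PairIso (normalizerIn S P) P M Q g) :
    F.ExtendsToCentralizer Q (g ∘ f) := by
  induction h generalizing g M with
  | refl hf =>
    refine (hg.extendsToCentralizer centralizerIn_le_normalizerIn).congr fun x hx => ?_
    rw [Function.comp_apply, hf hx, id]
  | step hf hk hh ih =>
    rename_i f k h
    have hfi := hf.isoOn (fun _ _ _ h => h.isoOn) hQ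
    obtain ⟨χ, N, hχ⟩ := htop _ _ hfi
    obtain ⟨X, X', hlt, hX, hkX⟩ := hk.exists_le_normalizerIn hS
    obtain ⟨M', -, hM'⟩ := hg.restrict hkX.cod_le (hkX.le_normalizerIn (hX.trans inf_le_right))
    obtain ⟨N', -, hN'⟩ := hχ.restrict hkX.le hX
    obtain ⟨χ', hχ', hχχ, -⟩ := hN'.symm
    have hcard := card_lt_of_lt_of_le hkX.isoOn.dom_le hlt
    rw [← hfi.card_eq, hN'.isoOn.card_eq] at hcard
    refine ((((hM'.comp hkX).comp hχ').extendsToCentralizer_of_saturatedAt hS hsat htop hcard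
      (hN'.le_normalizerIn (hX.trans inf_le_right))).comp (ih hχ)
      fun x hx => hχ.isoOn_sub.apply_mem (hfi.apply_mem hx)).congr fun x hx => ?_
    simp only [Function.comp_apply, hχχ (hkX.le (hfi.apply_mem hx)), hh hx]

theorem SylowReceptive.receptive_of_extendsToCentralizer (hS : IsPGroup p S)
    {hU : Q ⊔ centralizerIn S Q ≤ S} (h : F.SylowReceptive p hU Q)
    (htop : ∀ P f, F.IsoOn Q P f → F.NormalizerArrow P Q)
    (hext : ∀ f, F.IsoOn Q Q f → F.ExtendsToCentralizer Q f) : F.Receptive Q := by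
  intro P Y f hf hY hYf
  obtain ⟨f', hf', -⟩ := hf.symm
  obtain ⟨ψ, M, hψ⟩ := htop P f' hf'
  obtain ⟨ψ', hψ', hψψ, -⟩ := hψ.symm
  obtain ⟨σ, hσ, hσf⟩ := hext _ (hf.comp hψ'.isoOn_sub)
  have hσψ {x : G} (hx : x ∈ P) : σ (ψ x) = f x := by
    rw [hσf (hψ.isoOn_sub.apply_mem hx), Function.comp_apply, hψψ (hψ.le hx)]
  obtain ⟨Y', hY'M, hψY⟩ := hψ.isoOn.restrict hY
  have hY' : Y' ≤ normalizerIn S Q := hY'M.trans (hψ.le_normalizerIn inf_le_right)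
  have hNU := normalizerIn_le_normalizer_sup_centralizerIn (S := S) (Q := Q)
  have hσ' : F.PairIso _ Q _ Q σ :=
    ⟨le_sup_left, hσ, (hf.comp hψ'.isoOn_sub).congr hσf⟩
  obtain ⟨a, ha, -, haσ⟩ := h.exists_extension_eqOn hS hσ'
    (le_inf (le_inf hψY.cod_le (hY'.trans hNU)) hY') fun y hy => by
      obtain ⟨y, hyY, rfl⟩ := hψY.surjOn hy
      have hyP := (hY hyY).2
      obtain ⟨t, ht, hty⟩ := hYf y hyY
      have : Finite Q := Finite.of_injective _ (Subgroup.inclusion_injective hf.cod_le)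
      have htQ : t ∈ Subgroup.normalizer (Q : Set G) := by
        refine Subgroup.mem_normalizer_fintype fun z hz => ?_
        obtain ⟨x, hx, rfl⟩ := hf.surjOn hz
        rw [← hty x hx]
        exact hf.apply_mem ((Subgroup.mem_normalizer_iff.1 hyP x).1 hx)
      refine ⟨t, ⟨ht, hNU ⟨ht, htQ⟩⟩, fun z hz => ?_⟩
      obtain ⟨x, hx, rfl⟩ := hψ.isoOn_sub.surjOn hz
      rw [← hψ.isoOn.map_conj (hY hyY) (hψ.le hx),
        hσψ ((Subgroup.mem_normalizer_iff.1 hyP x).1 hx), hσψ hx, hty x hx]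
  obtain ⟨M', -, hM'⟩ := hψ.restrict le_sup_left (sup_le hψ.le hY)
  refine ⟨a ∘ ψ, ha.comp hM'.isoOn ?_, fun x hx => ?_⟩
  · rw [← SetLike.coe_subset_coe, ← hM'.isoOn.image_eq]
    exact (hM'.isoOn.mapsTo_sup le_sup_left le_sup_right
      (fun x hx => Subgroup.mem_sup_left (Subgroup.mem_sup_left (hψ.isoOn_sub.apply_mem hx)))
      fun x hx => Subgroup.mem_sup_right (hψY.apply_mem hx)).image_subset
  · rw [Function.comp_apply, haσ (hψ.isoOn_sub.apply_mem hx), hσψ hx]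

theorem saturatedAt_of_not_centric (hS : IsPGroup p S) (hP : P ≤ S)
    (hsat : ∀ R ≤ S, Nat.card P < Nat.card R → F.SaturatedAt p R)
    (hgen : ∀ A B f g, F.IsoOn P A f → F.IsoOn A B g → CompositeOf F.ExtendsToLarger A B g)
    (hnc : ∀ A f, F.IsoOn P A f → ¬ centralizerIn S A ≤ A) : F.SaturatedAt p P := by
  obtain ⟨Q₁, f₁, hf₁, htop₁⟩ := exists_normalizerArrow_target hS hP hsat hgen
  have hU₁ := sup_centralizerIn_le_normalizerIn hf₁.cod_le
  have hlt : Nat.card P < Nat.card (Q₁ ⊔ centralizerIn S Q₁ : Subgroup G) := by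
    rw [hf₁.card_eq]
    exact card_lt_of_lt_of_le (hU₁.trans inf_le_left) (left_lt_sup.2 (hnc _ _ hf₁))
  obtain ⟨U, Q, hU, g, hg, h⟩ :=
    exists_sylowReceptive hS (hsat _ (hU₁.trans inf_le_left) hlt) le_sup_left
  have hgQ := hg.isoOn_sub.comp hf₁
  have harrow : F.NormalizerArrow Q₁ Q := by
    obtain ⟨g', M, hg'⟩ := h.exists_extension_normalizer hS hg
    obtain ⟨N, -, hN⟩ := hg'.restrict (le_normalizerIn hf₁.cod_le)
      (le_inf (le_inf inf_le_left normalizerIn_le_normalizer_sup_centralizerIn) le_rfl)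
    exact ⟨g', N, hN⟩
  have htop : ∀ A f, F.IsoOn Q A f → F.NormalizerArrow A Q := fun A f hf =>
    (htop₁ A _ (hf.comp hgQ)).trans harrow
  obtain rfl : U = Q ⊔ centralizerIn S Q := by
    obtain ⟨k, N, hk⟩ := htop₁ _ _ hgQ
    refine eq_of_le_of_card_le (sup_le hgQ.cod_le inf_le_left) ?_ ?_
    · rw [← SetLike.coe_subset_coe, ← hg.isoOn.image_eq]
      exact (hg.mapsTo_sup_centralizerIn le_sup_right).image_subset
    · rw [← hg.isoOn.card_eq]
      exact hk.card_sup_centralizerIn_le centralizerIn_le_normalizerIn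
  have hext : ∀ f, F.IsoOn Q Q f → F.ExtendsToCentralizer Q f := fun f hf => by
    have hid : F.PairIso (normalizerIn S Q) Q _ Q id :=
      .refl (le_normalizerIn hgQ.cod_le) inf_le_left
    have hsatQ := hgQ.card_eq ▸ hsat
    exact (hgen Q Q _ f hgQ hf).extendsToCentralizer (g := id) hS hgQ.cod_le hsatQ htop hid
  refine ⟨Q, hgQ.cod_le, _, hgQ, h.automized fun β hβ => ?_,
    h.receptive_of_extendsToCentralizer hS htop hext⟩
  obtain ⟨f', ⟨α, hα, hαf⟩, hf'⟩ := hext _ (mem_autF_iff.1 hβ)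
  exact ⟨α, hα, fun x => by rw [hαf, ← extendFun_coe β]; exact hf' x.2⟩

end FusionSystem

/-- The function `f` agrees on `P ≤ B` with an automorphism of `B` belonging to `D`, and
`f(P) = Q`. -/
def IsRestriction {G : Type*} [Group G] {B : Subgroup G} (D : Subgroup (MulAut B))
    (P Q : Subgroup G) (f : G → G) : Prop :=
  P ≤ B ∧ f '' P = Q ∧ ∃ k ∈ D, Set.EqOn f (extendFun k) P

namespace IsRestriction

variable {G : Type*} [Group G] {B P P' Q Q' R : Subgroup G} {D : Subgroup (MulAut B)} {f g : G → G}

theorem refl (hP : P ≤ B) : IsRestriction D P P id :=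
  ⟨hP, Set.image_id _, 1, D.one_mem, fun _ hx => by rw [extendFun_of_mem _ (hP hx)]; rfl⟩

theorem congr (h : IsRestriction D P Q f) (hfg : Set.EqOn g f P) : IsRestriction D P Q g :=
  let ⟨hP, him, k, hk, hfk⟩ := h
  ⟨hP, hfg.image_eq.trans him, k, hk, hfg.trans hfk⟩

theorem mapsTo (h : IsRestriction D P Q f) : Set.MapsTo f P Q :=
  Set.mapsTo_iff_image_subset.2 h.2.1.subset

theorem cod_le (h : IsRestriction D P Q f) : Q ≤ B := by
  obtain ⟨hP, him, k, -, hfk⟩ := h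
  rw [← SetLike.coe_subset_coe, ← him, Set.image_subset_iff]
  intro x hx
  rw [Set.mem_preimage, hfk hx, extendFun_of_mem _ (hP hx)]
  exact (k _).2

theorem comp (hg : IsRestriction D Q R g) (hf : IsRestriction D P Q f) :
    IsRestriction D P R (g ∘ f) := by
  obtain ⟨hP, hf', k, hk, hfk⟩ := id hf
  obtain ⟨-, hg', l, hl, hgl⟩ := hg
  refine ⟨hP, by rw [Set.image_comp, hf', hg'], l * k, D.mul_mem hl hk, fun x hx => ?_⟩
  rw [Function.comp_apply, hgl (hf.mapsTo hx), hfk hx, extendFun_of_mem k (hP hx), extendFun_coe,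
    extendFun_of_mem _ (hP hx), MulAut.mul_apply]

theorem symm (h : IsRestriction D P Q f) : ∃ g, IsRestriction D Q P g ∧ Set.InvOn g f P Q := by
  have hQ := h.cod_le
  obtain ⟨hP, him, k, hk, hfk⟩ := h
  have hinv : Set.LeftInvOn (extendFun ⇑k⁻¹) f P := fun x hx => by
    rw [hfk hx, extendFun_of_mem k (hP hx), extendFun_coe, MulAut.inv_apply_self]
  refine ⟨_, ⟨hQ, ?_, k⁻¹, D.inv_mem hk, fun _ _ => rfl⟩, hinv, ?_⟩
  · rw [← him, hinv.image_image]
  · rw [← him]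
    exact hinv.rightInvOn_image

theorem restrict (h : IsRestriction D P Q f) (hP' : P' ≤ P) (him : f '' P' = Q') :
    IsRestriction D P' Q' f :=
  let ⟨hP, _, k, hk, hfk⟩ := h
  ⟨hP'.trans hP, him, k, hk, hfk.mono hP'⟩

theorem of_mem {k : MulAut B} (hk : k ∈ D) : IsRestriction D B B (extendFun k) := by
  refine ⟨le_rfl, ?_, k, hk, fun _ _ => rfl⟩
  ext y
  constructor
  · rintro ⟨x, hx, rfl⟩
    rw [extendFun_of_mem _ hx]
    exact (k _).2
  · intro hy
    exact ⟨(k⁻¹ ⟨y, hy⟩ : B), (k⁻¹ _).2, by rw [extendFun_coe, MulAut.apply_inv_self]⟩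

theorem mem_of_self {k : MulAut B} (h : IsRestriction D B B (extendFun k)) : k ∈ D := by
  obtain ⟨-, -, l, hl, hkl⟩ := h
  rwa [show k = l from MulEquiv.ext fun x => Subtype.ext <| by
    simpa only [extendFun_coe] using hkl x.2]

variable {S : Subgroup G} {F : FusionSystem S} {hB : B ≤ S}

theorem exists_pairIso (h : IsRestriction D P Q f) (hD : D ≤ F.autF hB) :
    ∃ k, F.PairIso B P B Q k ∧ Set.EqOn k f P :=
  let ⟨hP, him, k, hk, hfk⟩ := h
  have hkF := FusionSystem.mem_autF_iff.1 (hD hk)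
  ⟨extendFun k, ⟨hP, hkF, hkF.restrict_of_image_eq hP (hfk.image_eq ▸ him)⟩, hfk.symm⟩

theorem isoOn (h : IsRestriction D P Q f) (hD : D ≤ F.autF hB) : F.IsoOn P Q f :=
  let ⟨_, hk, hkf⟩ := h.exists_pairIso hD
  hk.isoOn_sub.congr hkf.symm

theorem inducedAut (h : IsRestriction D P P f) (hD : D ≤ F.autF hB) (hP : P ≤ B) :
    IsRestriction (inducedAut hP D) P P f := by
  obtain ⟨α, -, hα⟩ := h.isoOn hD
  obtain ⟨-, him, k, hk, hfk⟩ := h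
  refine ⟨le_rfl, him, α, ⟨k, hk, fun x => ?_⟩, fun x hx => ?_⟩
  · rw [hα, hfk x.2, extendFun_of_mem _ (hP x.2)]
    rfl
  · rw [extendFun_of_mem _ hx, hα]

end IsRestriction

theorem isRestriction_conj {G : Type*} [Group G] {T : Subgroup G} {K : Subgroup (MulAut T)}
    (hK : innerAut T ≤ K) {t : G} (ht : t ∈ T) : IsRestriction K T T (fun x => t * x * t⁻¹) :=
  (IsRestriction.of_mem (hK ⟨⟨t, ht⟩, rfl⟩)).congr fun x hx => by
    rw [extendFun_of_mem _ hx]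
    rfl

namespace FusionSystem

variable {G : Type*} [Group G] {S P P' Q R : Subgroup G} {F : FusionSystem S}
  {r : Subgroup G → Subgroup G → (G → G) → Prop} {f g : G → G}

namespace CompositeOf

theorem congr (h : CompositeOf r P Q f) (hfg : Set.EqOn g f P) : CompositeOf r P Q g := by
  cases h with
  | refl hf => exact refl (hfg.trans hf)
  | step hf hg hh => exact step hf hg (hfg.trans hh)

theorem single (h : r P Q f) : CompositeOf r P Q f :=
  step (refl fun _ _ => rfl) h fun _ _ => rfl

theorem trans (hg : CompositeOf r Q R g) (hf : CompositeOf r P Q f) (hmaps : Set.MapsTo f P Q) :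
    CompositeOf r P R (g ∘ f) := by
  induction hg with
  | refl hg => exact hf.congr fun x hx => hg (hmaps hx)
  | step _ hb hc ih => exact step ih hb fun x hx => hc (hmaps hx)

end CompositeOf

/-- The isomorphisms in `r` belong to `F`, and `r` contains the conjugations by elements of `S` and
is closed under inverses and restrictions. The composites of members of `r` are then the
isomorphisms of a fusion system. -/
structure IsIsoClass (F : FusionSystem S) (r : Subgroup G → Subgroup G → (G → G) → Prop) :
    Prop where
  isoOn : ∀ ⦃P Q f⦄, r P Q f → F.IsoOn P Q f
  conj : ∀ t ∈ S, r S S fun x => t * x * t⁻¹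
  symm : ∀ ⦃P Q f⦄, r P Q f → ∃ g, r Q P g ∧ Set.InvOn g f P Q
  restrict : ∀ ⦃P Q f⦄, r P Q f → ∀ ⦃P' Q' : Subgroup G⦄, P' ≤ P → f '' P' = Q' → r P' Q' f

namespace IsIsoClass

variable (hr : F.IsIsoClass r)

include hr

theorem isoOn_of_compositeOf (hP : P ≤ S) (h : CompositeOf r P Q f) : F.IsoOn P Q f :=
  h.isoOn hr.isoOn hP

theorem symm_compositeOf (hP : P ≤ S) (h : CompositeOf r P Q f) :
    ∃ g, CompositeOf r Q P g ∧ Set.InvOn g f P Q := by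
  induction h with
  | refl hf => exact ⟨id, .refl fun _ _ => rfl, fun _ hx => hf hx, fun _ hx => hf hx⟩
  | step hf hg hh ih =>
    obtain ⟨f', hf', hinv⟩ := ih
    obtain ⟨g', hg', hinv'⟩ := hr.symm hg
    have hiso := hr.isoOn_of_compositeOf hP hf
    have hmaps := fun x => (hr.isoOn hg').apply_mem (x := x)
    have hmaps' := fun x => (hr.isoOn_of_compositeOf hiso.cod_le hf').apply_mem (x := x)
    have hcomp := hinv.comp hinv' (fun x => hiso.apply_mem (x := x)) hmaps
    exact ⟨f' ∘ g', hf'.trans (.single hg') hmaps, hcomp.1.congr_right hh.symm,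
      hcomp.2.congr_right (fun x hx => hmaps' _ (hmaps _ hx)) hh.symm⟩

theorem restrict_compositeOf (h : CompositeOf r P Q f) (hP' : P' ≤ P) :
    ∃ Q' ≤ Q, CompositeOf r P' Q' f := by
  induction h with
  | refl hf => exact ⟨P', hP', .refl (hf.mono hP')⟩
  | step _ hg hh ih =>
    obtain ⟨Q', hQ', hf'⟩ := ih
    obtain ⟨R', hR', hgi⟩ := (hr.isoOn hg).restrict hQ'
    exact ⟨R', hR', hf'.step (hr.restrict hg hQ' hgi.image_eq) (hh.mono hP')⟩

/-- The fusion system whose isomorphisms are the composites of members of `r`. -/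
def compositeSystem : FusionSystem S where
  Hom P Q := {φ | P ≤ S ∧ Q ≤ S ∧ ∃ R ≤ Q, CompositeOf r P R (extendFun φ)}
  dom_le h := h.1
  cod_le h := h.2.1
  injective := by
    rintro P Q φ ⟨hP, -, R, -, hφ⟩ x y hxy
    refine Subtype.ext ((hr.isoOn_of_compositeOf hP hφ).injOn x.2 y.2 ?_)
    rw [extendFun_coe, extendFun_coe, hxy]
  conj_mem := by
    rintro P Q φ hP hQ ⟨t, ht, h⟩
    have hconj : Set.EqOn (extendFun φ) (fun x => t * x * t⁻¹) P := fun x hx => by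
      rw [extendFun_of_mem _ hx, h]
    obtain ⟨R, -, hR⟩ := (hr.isoOn (hr.conj t ht)).restrict hP
    refine ⟨hP, hQ, R, ?_, .congr (.single (hr.restrict (hr.conj t ht) hP hR.image_eq)) hconj⟩
    rw [← SetLike.coe_subset_coe, ← hR.image_eq, ← hconj.image_eq, Set.image_subset_iff]
    intro x hx
    rw [Set.mem_preimage, extendFun_of_mem _ hx]
    exact (φ _).2
  comp_mem := by
    rintro P Q R ψ φ ⟨-, hR, A, hA, hψ⟩ ⟨hP, -, B, hB, hφ⟩
    obtain ⟨C, hC, hc⟩ := hr.restrict_compositeOf hψ hB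
    refine ⟨hP, hR, C, hC.trans hA, (hc.trans hφ fun _ hx =>
      (hr.isoOn_of_compositeOf hP hφ).apply_mem hx).congr fun x hx => ?_⟩
    rw [Function.comp_apply, extendFun_of_mem φ hx, extendFun_coe, extendFun_of_mem _ hx,
      MonoidHom.comp_apply]
  factor := by
    rintro P Q φ ⟨hP, hQ, R, hR, hφ⟩
    obtain ⟨g, hg, hgφ, -⟩ := hr.symm_compositeOf hP hφ
    obtain ⟨e, -, he⟩ := hr.isoOn_of_compositeOf hP hφ
    refine ⟨R, hR, e, ⟨hP, hR.trans hQ, R, le_rfl, hφ.congr fun x hx => ?_⟩,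
      ⟨hR.trans hQ, hP, P, le_rfl, hg.congr fun y hy => ?_⟩, ?_⟩
    · rw [extendFun_of_mem _ hx]
      exact he ⟨x, hx⟩
    · rw [extendFun_of_mem _ hy]
      obtain ⟨x, hx⟩ := e.surjective ⟨y, hy⟩
      obtain rfl : (e x : G) = y := congrArg Subtype.val hx
      change ((e.symm (e x) : P) : G) = g (e x)
      rw [e.symm_apply_apply, he, hgφ x.2]
    · ext x
      exact (extendFun_coe φ x).symm.trans (he x).symm

theorem compositeOf_of_isoOn_generate
    {X : Set (Σ P : Subgroup G, Σ Q : Subgroup G, P →* Q)}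
    (hX : ∀ m ∈ X, m.2.1 ≤ S ∧ ∃ R ≤ m.2.1, r m.1 R (extendFun m.2.2))
    (h : (generate S X).IsoOn P Q f) : CompositeOf r P Q f := by
  obtain ⟨α, hα, hαf⟩ := h
  obtain ⟨hP, -, R, hR, hc⟩ := hα.2.2.2 hr.compositeSystem fun m hm => by
    obtain ⟨hm', R, hR, hrm⟩ := hX m hm
    exact ⟨(hr.isoOn hrm).dom_le, hm', R, hR, .single hrm⟩
  have hfα : Set.EqOn f (extendFun α.toMonoidHom) P := fun x hx => by
    rw [extendFun_of_mem _ hx, ← hαf ⟨x, hx⟩]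
    rfl
  obtain rfl : R = Q := by
    refine le_antisymm hR fun y hy => ?_
    obtain ⟨x, hx⟩ := α.surjective ⟨y, hy⟩
    have hxR := (hr.isoOn_of_compositeOf hP hc).apply_mem x.2
    rwa [extendFun_coe, show α.toMonoidHom x = ⟨y, hy⟩ from hx] at hxR
  exact hc.congr hfα

end IsIsoClass

end FusionSystem

theorem autConj_self {G : Type*} [Group G] (S : Subgroup G) : autConj S S = innerAut S := by
  ext α
  constructor
  · rintro ⟨g, hg, h⟩
    exact ⟨⟨g, hg⟩, MulEquiv.ext fun x => Subtype.ext (h x).symm⟩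
  · rintro ⟨g, rfl⟩
    exact ⟨g, g.2, fun _ => rfl⟩

theorem inducedAut_mono {G : Type*} [Group G] {P T : Subgroup G} (hP : P ≤ T)
    {K L : Subgroup (MulAut T)} (h : K ≤ L) : inducedAut hP K ≤ inducedAut hP L :=
  fun _ ⟨α, hα, hβ⟩ => ⟨α, h hα, hβ⟩

theorem inducedAut_innerAut {G : Type*} [Group G] {P T : Subgroup G} (hP : P ≤ T) :
    inducedAut hP (innerAut T) = autConj T P := by
  refine le_antisymm (autConj_self T ▸ inducedAut_autConj_le hP) fun β ⟨t, ht, hβ⟩ => ?_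
  exact ⟨_, ⟨⟨t, ht⟩, rfl⟩, fun x => (hβ x).symm⟩

theorem autConj_relIndex_inducedAut_dvd {G : Type*} [Group G] {P T : Subgroup G} (hP : P ≤ T)
    (K : Subgroup (MulAut T)) :
    (autConj T P).relIndex (inducedAut hP K) ∣ (innerAut T).relIndex K := by
  rw [← inducedAut_innerAut hP]
  exact (inducedAut_relIndex_dvd hP _ _).trans (relIndex_dvd_relIndex_of_normal _ inf_le_left)

namespace FusionSystem

variable {G : Type*} [Group G] {T E P Q : Subgroup G} {K : Subgroup (MulAut T)}
  {D : Subgroup (MulAut E)} {f : G → G} {p : ℕ}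

/-- The fusion system on `T` generated by `K ≤ Aut(T)` and `D ≤ Aut(E)`. -/
abbrev pairSystem (K : Subgroup (MulAut T)) (D : Subgroup (MulAut E)) : FusionSystem T :=
  generate T (autMorphisms K ∪ autMorphisms D)

theorem le_autF_pairSystem_left : K ≤ (pairSystem K D).autF le_rfl := fun k hk =>
  ⟨le_rfl, le_rfl, k.injective, fun _ hF => hF ⟨T, T, k.toMonoidHom⟩ (Or.inl ⟨k, hk, rfl⟩)⟩

theorem le_autF_pairSystem_right (hE : E ≤ T) : D ≤ (pairSystem K D).autF hE := fun k hk =>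
  ⟨hE, hE, k.injective, fun _ hF => hF ⟨E, E, k.toMonoidHom⟩ (Or.inr ⟨k, hk, rfl⟩)⟩

theorem isIsoClass_pairSystem (hK : innerAut T ≤ K) (hE : E ≤ T) :
    (pairSystem K D).IsIsoClass (IsRestriction K ⊔ IsRestriction D) where
  isoOn _ _ _ h := h.elim (fun h => h.isoOn le_autF_pairSystem_left) fun h =>
    h.isoOn (le_autF_pairSystem_right hE)
  conj _ ht := Or.inl (isRestriction_conj hK ht)
  symm _ _ _ h := h.elim (fun h => h.symm.imp fun _ => And.imp_left Or.inl) fun h =>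
    h.symm.imp fun _ => And.imp_left Or.inr
  restrict _ _ _ h _ _ hP him := h.imp (fun h => h.restrict hP him) fun h => h.restrict hP him

theorem compositeOf_of_isoOn_pairSystem (hK : innerAut T ≤ K) (hE : E ≤ T)
    (h : (pairSystem K D).IsoOn P Q f) :
    CompositeOf (IsRestriction K ⊔ IsRestriction D) P Q f := by
  refine (isIsoClass_pairSystem hK hE).compositeOf_of_isoOn_generate ?_ h
  rintro _ (⟨k, hk, rfl⟩ | ⟨k, hk, rfl⟩)
  · exact ⟨le_rfl, T, le_rfl, Or.inl (IsRestriction.of_mem hk)⟩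
  · exact ⟨hE, E, le_rfl, Or.inr (IsRestriction.of_mem hk)⟩

namespace CompositeOf

theorem isRestriction_left (hP : P ≤ T) (hPE : ∀ P₁ f, P₁ ≤ E → ¬ IsRestriction K P P₁ f)
    (h : CompositeOf (IsRestriction K ⊔ IsRestriction D) P Q f) : IsRestriction K P Q f := by
  induction h with
  | refl hf => exact (IsRestriction.refl hP).congr hf
  | step _ hg hh ih =>
    exact hg.elim (fun hg => (hg.comp ih).congr hh) fun hg => absurd ih (hPE _ _ hg.1)

theorem exists_isRestriction_comp [Finite T] (hE : E ≤ T) (hKD : inducedAut hE K ≤ D)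
    (h : CompositeOf (IsRestriction K ⊔ IsRestriction D) E Q f) :
    ∃ a b, IsRestriction D E E a ∧ IsRestriction K E Q b ∧ Set.EqOn f (b ∘ a) E := by
  have hKF : K ≤ (pairSystem K D).autF le_rfl := le_autF_pairSystem_left
  have hDF : D ≤ (pairSystem K D).autF hE := le_autF_pairSystem_right hE
  induction h with
  | refl hf => exact ⟨id, id, .refl le_rfl, .refl hE, hf⟩
  | @step Q R f g h _ hg hh ih =>
    obtain ⟨a, b, ha, hb, hf⟩ := ih
    have hh' : Set.EqOn h (g ∘ b ∘ a) E := fun x hx => (hh hx).trans (congrArg g (hf hx))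
    rcases hg with hg | hg
    · exact ⟨a, _, ha, hg.comp hb, hh'⟩
    · obtain rfl : Q = E := eq_of_le_of_card_le hE hg.1 (hb.isoOn hKF).card_eq.le
      obtain rfl : R = Q := eq_of_le_of_card_le hE hg.cod_le (hg.isoOn hDF).card_eq.le
      obtain ⟨-, hbQ, k, hk, hbk⟩ := hb.inducedAut hKF hE
      have hbD : IsRestriction D R R b := ⟨le_rfl, hbQ, k, hKD hk, hbk⟩
      exact ⟨_, id, hg.comp (hbD.comp ha), .refl hE, hh'⟩

theorem exists_isRestriction_lt [Finite T] (hE : E ≤ T)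
    (hP : ∃ P₁ < E, ∃ a, IsRestriction K P P₁ a)
    (h : CompositeOf (IsRestriction K ⊔ IsRestriction D) P Q f) :
    ∃ Q₁ < E, ∃ a, IsRestriction K Q Q₁ a := by
  have hKF : K ≤ (pairSystem K D).autF le_rfl := le_autF_pairSystem_left
  have hDF : D ≤ (pairSystem K D).autF hE := le_autF_pairSystem_right hE
  induction h with
  | refl _ => exact hP
  | step _ hg _ ih =>
    obtain ⟨Q₁, hQ₁, a, ha⟩ := ih
    rcases hg with hg | hg
    · obtain ⟨g', hg', -⟩ := hg.symm
      exact ⟨Q₁, hQ₁, _, ha.comp hg'⟩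
    · have hlt := card_lt_of_lt_of_le hE hQ₁
      rw [← (ha.isoOn hKF).card_eq, (hg.isoOn hDF).card_eq] at hlt
      exact ⟨_, lt_of_le_of_ne hg.cod_le fun h => (h ▸ hlt).false, id, .refl (hg.cod_le.trans hE)⟩

theorem of_card_lt [Finite T] (hE : E ≤ T) (hP : P ≤ T) (hc : Nat.card P < Nat.card E)
    (h : CompositeOf (IsRestriction K ⊔ IsRestriction D) P Q f) :
    CompositeOf (pairSystem K D).ExtendsToLarger P Q f := by
  have hKF : K ≤ (pairSystem K D).autF le_rfl := le_autF_pairSystem_left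
  have hDF : D ≤ (pairSystem K D).autF hE := le_autF_pairSystem_right hE
  induction h with
  | refl hf => exact .refl hf
  | @step Q R f g h _ hg hh ih =>
    have hf := ih.isoOn (fun _ _ _ => ExtendsToLarger.isoOn) hP
    obtain ⟨X, k, hX, hk, hkg⟩ : ∃ (X : Subgroup G) (k : G → G), Nat.card E ≤ Nat.card X ∧
        (pairSystem K D).PairIso X Q X R k ∧ Set.EqOn k g Q := by
      rcases hg with hg | hg
      · obtain ⟨k, hk⟩ := hg.exists_pairIso hKF
        exact ⟨T, k, card_le_of_le_of_le le_rfl hE, hk⟩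
      · obtain ⟨k, hk⟩ := hg.exists_pairIso hDF
        exact ⟨E, k, le_rfl, hk⟩
    have hQX : Q < X := lt_of_le_of_ne hk.le fun hQX => by
      rw [hf.card_eq, hQX] at hc
      exact hX.not_gt hc
    exact ih.step ⟨X, X, hQX, hk⟩ fun x hx => (hh hx).trans (hkg (hf.apply_mem hx)).symm

end CompositeOf

theorem saturatedAt_pairSystem_of_not_le (hK : innerAut T ≤ K)
    (hKi : ¬ p ∣ (innerAut T).relIndex K) (hE : E ≤ T) (hP : P ≤ T)
    (hPE : ∀ P₁ f, P₁ ≤ E → ¬ IsRestriction K P P₁ f) : (pairSystem K D).SaturatedAt p P := by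
  have hKF : K ≤ (pairSystem K D).autF le_rfl := le_autF_pairSystem_left
  have hiso : ∀ Q f, (pairSystem K D).IsoOn P Q f → IsRestriction K P Q f := fun _ _ h =>
    (compositeOf_of_isoOn_pairSystem hK hE h).isRestriction_left hP hPE
  have haut : (pairSystem K D).autF hP ≤ inducedAut hP K := fun β hβ =>
    ((hiso P _ (mem_autF_iff.1 hβ)).inducedAut hKF hP).mem_of_self
  refine ⟨P, hP, id, .refl hP, fun h => hKi ?_, fun P' Y f hf hY _ => ?_⟩
  · rw [haut.antisymm ((inducedAut_mono hP hKF).trans (inducedAut_autF_le hP le_rfl))] at h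
    exact h.trans (autConj_relIndex_inducedAut_dvd hP K)
  · obtain ⟨f', hf', hinv⟩ := hf.symm
    obtain ⟨f'', hf'', hinv'⟩ := (hiso _ _ hf').symm
    obtain ⟨k, hk, hkf⟩ := hf''.exists_pairIso hKF
    refine ⟨k, hk.isoOn.morOn.restrict (sup_le hf.dom_le (hY.trans inf_le_left)), fun x hx => ?_⟩
    rw [hkf hx, ← hinv.1 hx, hinv'.1 (hf.apply_mem hx), hinv.1 hx]

theorem autF_pairSystem [Finite T] (hK : innerAut T ≤ K) (hE : E ≤ T) (hKD : inducedAut hE K ≤ D) :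
    (pairSystem K D).autF hE = D := by
  refine le_antisymm (fun β hβ => ?_) (le_autF_pairSystem_right hE)
  obtain ⟨a, b, ha, hb, hβab⟩ := (compositeOf_of_isoOn_pairSystem hK hE
    (mem_autF_iff.1 hβ)).exists_isRestriction_comp hE hKD
  obtain ⟨-, him, k, hk, hbk⟩ := hb.inducedAut (F := pairSystem K D) le_autF_pairSystem_left hE
  have hbD : IsRestriction D E E b := ⟨le_rfl, him, k, hKD hk, hbk⟩
  exact ((hbD.comp ha).congr hβab).mem_of_self

theorem exists_isRestriction_comp_of_isoOn [Finite T] (hK : innerAut T ≤ K) (hE : E ≤ T)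
    (hKD : inducedAut hE K ≤ D) (hf : (pairSystem K D).IsoOn P E f) :
    ∃ δ ∈ D, ∃ b, IsRestriction K P E b ∧ Set.EqOn f (extendFun δ ∘ b) P := by
  obtain ⟨f', hf', hinv⟩ := hf.symm
  obtain ⟨a, b, ha, hb, hab⟩ :=
    (compositeOf_of_isoOn_pairSystem hK hE hf').exists_isRestriction_comp hE hKD
  obtain ⟨a', ⟨-, -, δ, hδ, ha'δ⟩, ha'⟩ := ha.symm
  obtain ⟨b', hb', hbb'⟩ := hb.symm
  refine ⟨δ, hδ, b', hb', fun x hx => ?_⟩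
  have hfx := hf.apply_mem hx
  have hx' : b (a (f x)) = x := (hab hfx).symm.trans (hinv.1 hx)
  have hbx : b' x = a (f x) := by rw [← hx', hbb'.1 (ha.mapsTo hfx), hx']
  rw [Function.comp_apply, ← ha'δ (hb'.mapsTo hx), hbx, ha'.1 hfx]

theorem receptive_pairSystem_self [Finite T] (hK : innerAut T ≤ K) (hE : E ≤ T)
    (hKD : inducedAut hE K ≤ D)
    (hDK : ∀ δ ∈ D, ¬ extensionControl T δ ≤ E → δ ∈ inducedAut hE K) :
    (pairSystem K D).Receptive E := by
  intro P Y f hf hY hYf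
  have hKF : K ≤ (pairSystem K D).autF le_rfl := le_autF_pairSystem_left
  obtain ⟨δ, hδ, b, hb, hfδ⟩ := exists_isRestriction_comp_of_isoOn hK hE hKD hf
  by_cases hδK : δ ∈ inducedAut hE K
  · obtain ⟨α, hα, hαδ⟩ := hδK
    have hαb : IsRestriction K E E (extendFun δ) := by
      refine ⟨hE, (IsRestriction.of_mem hδ).2.1, α, hα, fun x hx => ?_⟩
      rw [extendFun_of_mem _ hx, extendFun_of_mem _ (hE hx), ← hαδ]
      rfl
    obtain ⟨k, hk, hkf⟩ := ((hαb.comp hb).congr hfδ).exists_pairIso hKF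
    exact ⟨k, hk.isoOn.morOn.restrict (sup_le hf.dom_le (hY.trans inf_le_left)), hkf⟩
  · obtain ⟨k, hk, hkb⟩ := hb.exists_pairIso hKF
    obtain ⟨N, -, hkN⟩ := hk.restrict (_root_.le_normalizerIn hf.dom_le)
      (inf_le_left : normalizerIn T P ≤ T)
    have hYP : Y ≤ P := fun y hy => by
      have hyT : y ∈ T := (hY hy).1
      refine (hk.apply_mem_iff hyT).1 (of_not_not fun hky => hδK (hDK δ hδ fun hle => hky (hle ?_)))
      obtain ⟨t, ht, htf⟩ := hYf y hy
      refine (mem_extensionControl_iff fun x => (extendFun_coe δ x).symm).2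
        ⟨hkN.le_normalizerIn inf_le_right (hkN.isoOn.apply_mem (hY hy)), t, ht, fun z hz => ?_⟩
      obtain ⟨x, hx, rfl⟩ := hk.isoOn_sub.surjOn hz
      have hx' := (Subgroup.mem_normalizer_iff.1 (hY hy).2 x).1 hx
      have hfk : Set.EqOn f (extendFun δ ∘ k) P := fun x hx => by
        rw [hfδ hx, Function.comp_apply, Function.comp_apply, hkb hx]
      rw [← hk.isoOn.map_conj hyT (hk.le hx)]
      exact (hfk hx').symm.trans ((htf x hx).trans (by rw [hfk hx, Function.comp_apply]))
    exact ⟨f, hf.morOn.restrict (sup_le le_rfl hYP), fun _ _ => rfl⟩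

theorem saturatedAt_pairSystem_self [Finite T] (hK : innerAut T ≤ K) (hE : E ≤ T)
    (hKD : inducedAut hE K ≤ D) (hDi : ¬ p ∣ (autConj T E).relIndex D)
    (hDK : ∀ δ ∈ D, ¬ extensionControl T δ ≤ E → δ ∈ inducedAut hE K) :
    (pairSystem K D).SaturatedAt p E := by
  refine ⟨E, hE, id, .refl hE, ?_, receptive_pairSystem_self hK hE hKD hDK⟩
  rwa [Automized, autF_pairSystem hK hE hKD]

theorem isSaturated_pairSystem [Fact p.Prime] [Finite T] (hT : IsPGroup p T)
    (hK : innerAut T ≤ K) (hKi : ¬ p ∣ (innerAut T).relIndex K) (hE : E ≤ T)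
    (hKD : inducedAut hE K ≤ D) (hDi : ¬ p ∣ (autConj T E).relIndex D)
    (hDK : ∀ δ ∈ D, ¬ extensionControl T δ ≤ E → δ ∈ inducedAut hE K)
    (hmin : ∀ P < E, ¬ centralizerIn T P ≤ P) : (pairSystem K D).IsSaturated p := by
  have hKF : K ≤ (pairSystem K D).autF le_rfl := le_autF_pairSystem_left
  refine (isSaturated_iff hT).2 fun P hP => ?_
  induction hn : Nat.card T - Nat.card P using Nat.strong_induction_on generalizing P with
  | _ n ih =>
    by_cases hPE : ∀ P₁ f, P₁ ≤ E → ¬ IsRestriction K P P₁ f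
    · exact saturatedAt_pairSystem_of_not_le hK hKi hE hP hPE
    push Not at hPE
    obtain ⟨P₁, a, hP₁, ha⟩ := hPE
    rcases hP₁.eq_or_lt with rfl | hlt
    · exact (saturatedAt_pairSystem_self hK hE hKD hDi hDK).of_isoOn (ha.isoOn hKF)
    have hc : Nat.card P < Nat.card E :=
      (ha.isoOn hKF).card_eq ▸ card_lt_of_lt_of_le hE hlt
    refine saturatedAt_of_not_centric hT hP (fun R hR hPR => ih _ ?_ R hR rfl)
      (fun A B f g hf hg => ?_) fun A f hf hA => ?_
    · have := card_le_of_le_of_le le_rfl hR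
      omega
    · exact (compositeOf_of_isoOn_pairSystem hK hE hg).of_card_lt hE hf.cod_le (hf.card_eq ▸ hc)
    · obtain ⟨A₁, hA₁, b, hb⟩ := (compositeOf_of_isoOn_pairSystem hK hE hf).exists_isRestriction_lt
        hE ⟨P₁, hlt, a, ha⟩
      obtain ⟨k, hk, -⟩ := hb.exists_pairIso hKF
      refine hmin A₁ hA₁ fun c hc => ?_
      obtain ⟨z, hz, rfl⟩ := hk.isoOn.surjOn hc.1
      obtain ⟨k', hk', hinv⟩ := hk.symm
      have hzA := hk'.apply_mem_centralizerIn hc.1 hc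
      rw [hinv.1 hz] at hzA
      exact hk.isoOn_sub.apply_mem (hA hzA)

end FusionSystem

section StronglyEmbedded

variable {H : Type*} [Group H] [Finite H] {p : ℕ} [Fact p.Prime] {N P M : Subgroup H}

theorem exists_conj_mem_of_pow_eq_one (hP : IsPGroup p P) (hPM : P ≤ M)
    (hi : ¬ p ∣ P.relIndex M) {x : H} (hx : x ∈ M) {k : ℕ} (hk : x ^ p ^ k = 1) :
    ∃ m ∈ M, m * x * m⁻¹ ∈ P := by
  have hxp : IsPGroup p (Subgroup.zpowers x) :=
    IsPGroup.of_card_dvd_pow (n := k) (Nat.card_zpowers x ▸ orderOf_dvd_of_pow_eq_one hk)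
  obtain ⟨m, hm, h⟩ := exists_map_conj_le_of_le_sup hP (hPM.trans Subgroup.le_normalizer)
    (by rwa [sup_of_le_left hPM]) hxp
    ((Subgroup.zpowers_le.2 hx).trans le_sup_left)
  exact ⟨m, hm, h ⟨x, Subgroup.mem_zpowers x, rfl⟩⟩

theorem mem_of_conj_mem_of_pow_eq_one [N.Normal] (hP : IsPGroup p P) (hi : ¬ p ∣ P.index)
    (hPM : P ≤ M) (h : ∀ g, ∀ x ∈ P, x ∉ N → g * x * g⁻¹ ∈ P → g ∈ M) {g x : H} (hx : x ∈ M)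
    (hxN : x ∉ N) {k : ℕ} (hk : x ^ p ^ k = 1) (hg : g * x * g⁻¹ ∈ M) : g ∈ M := by
  have hiM : ¬ p ∣ P.relIndex M := fun hd => hi (hd.trans (Subgroup.relIndex_dvd_index_of_le hPM))
  obtain ⟨m, hm, hmP⟩ := exists_conj_mem_of_pow_eq_one hP hPM hiM hx hk
  obtain ⟨n, hn, hnP⟩ := exists_conj_mem_of_pow_eq_one hP hPM hiM hg
    (show (g * x * g⁻¹) ^ p ^ k = 1 by rw [conj_pow, hk, mul_one, mul_inv_cancel])
  have hmN : m * x * m⁻¹ ∉ N := fun hmN => hxN <| by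
    simpa [mul_assoc] using ‹N.Normal›.conj_mem _ hmN m⁻¹
  have hgM := h (n * g * m⁻¹) _ hmP hmN (by simpa [mul_assoc] using hnP)
  rwa [Subgroup.mul_mem_cancel_right _ (inv_mem hm), Subgroup.mul_mem_cancel_left _ hn] at hgM

theorem isStronglyEmbedded_map_mk [N.Normal] (hP : IsPGroup p P) (hi : ¬ p ∣ P.index) (hNP : N < P)
    (hPM : P ≤ M) (hM : M ≠ ⊤) (h : ∀ g, ∀ x ∈ P, x ∉ N → g * x * g⁻¹ ∈ P → g ∈ M) :
    IsStronglyEmbedded p (M.map (QuotientGroup.mk' N)) := by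
  have hcomap : (M.map (QuotientGroup.mk' N)).comap (QuotientGroup.mk' N) = M :=
    Subgroup.comap_map_eq_self ((QuotientGroup.ker_mk' N).trans_le (hNP.le.trans hPM))
  have hmem (x : H) : QuotientGroup.mk' N x ∈ M.map (QuotientGroup.mk' N) ↔ x ∈ M := by
    rw [← Subgroup.mem_comap, hcomap]
  have hone (x : H) : QuotientGroup.mk' N x = 1 ↔ x ∈ N := QuotientGroup.eq_one_iff x
  refine ⟨fun htop => hM ?_, ?_, fun g hg hdvd => ?_⟩
  · rw [← hcomap, htop, Subgroup.comap_top]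
  · obtain ⟨x, hxP, hxN⟩ := SetLike.exists_of_lt hNP
    have hnt : Nontrivial (P.map (QuotientGroup.mk' N)) :=
      ⟨⟨⟨_, x, hxP, rfl⟩, 1, fun hx => hxN ((hone x).1 (congrArg Subtype.val hx))⟩⟩
    exact ((hP.map _).card_eq_or_dvd.resolve_left Finite.one_lt_card.ne').trans
      (Subgroup.card_dvd_of_le (Subgroup.map_mono hPM))
  · obtain ⟨g, rfl⟩ := QuotientGroup.mk'_surjective N g
    obtain ⟨⟨y, hy⟩, hord⟩ := exists_prime_orderOf_dvd_card' p hdvd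
    rw [Subgroup.orderOf_mk] at hord
    obtain ⟨⟨x, hxM, rfl⟩, z, hz, hzx⟩ := hy
    have hzx : z = QuotientGroup.mk' N (g⁻¹ * x * g⁻¹⁻¹) := by
      rw [map_mul, map_mul, ← hzx]
      simp [mul_assoc]
    have hxN : x ∉ N := fun hxN => by
      rw [(hone x).2 hxN, orderOf_one] at hord
      exact (Fact.out : p.Prime).ne_one hord.symm
    have hxp : x ^ p ∈ N := by rw [← hone, map_pow, ← hord, pow_orderOf_eq_one]
    obtain ⟨k, hk⟩ := hP.to_le hNP.le ⟨_, hxp⟩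
    have hk : x ^ p ^ (k + 1) = 1 := by
      rw [pow_succ', pow_mul]
      exact congrArg Subtype.val hk
    rw [hzx] at hz
    exact hg ((hmem g).2 (inv_mem_iff.1
      (mem_of_conj_mem_of_pow_eq_one hP hi hPM h hxM hxN hk ((hmem _).1 hz))))

end StronglyEmbedded

section ConjugationAutomorphisms

variable {G : Type*} [Group G] {S T P Q : Subgroup G}

theorem autConj_mono (h : T ≤ S) : autConj T P ≤ autConj S P :=
  fun _ ⟨t, ht, hα⟩ => ⟨t, h ht, hα⟩

theorem extensionControl_mono (h : T ≤ S) (α : P ≃* Q) :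
    extensionControl T α ≤ extensionControl S α :=
  fun _ ⟨hg, hn, hα⟩ => ⟨h hg, hn, autConj_mono h hα⟩

theorem innerAut_le_autConj (hP : P ≤ S) : innerAut P ≤ autConj S P :=
  autConj_self P ▸ autConj_mono hP

theorem innerAut_lt_autConj {p : ℕ} [Fact p.Prime] [Finite S] (hS : IsPGroup p S) (hP : P < S)
    (hc : centralizerIn S P ≤ P) : innerAut P < autConj S P := by
  refine SetLike.lt_iff_le_and_exists.2 ⟨innerAut_le_autConj hP.le, ?_⟩
  obtain ⟨t, ht, htn, htP⟩ := exists_mem_normalizerIn_notMem hS le_rfl hP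
  refine ⟨P.normalizerMonoidHom ⟨t, htn.2⟩, ⟨t, ht, fun _ => rfl⟩, fun ⟨r, hr⟩ => htP ?_⟩
  have hcent : (r : G)⁻¹ * t ∈ centralizerIn S P := by
    refine ⟨S.mul_mem (S.inv_mem (hP.le r.2)) ht, Subgroup.mem_centralizer_iff.2 fun y hy => ?_⟩
    have hrt : (r : G) * y * (r : G)⁻¹ = t * y * t⁻¹ :=
      congrArg Subtype.val (DFunLike.congr_fun hr (⟨y, hy⟩ : P))
    calc y * ((r : G)⁻¹ * t) = (r : G)⁻¹ * (r * y * (r : G)⁻¹) * t := by group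
      _ = (r : G)⁻¹ * t * y := by rw [hrt]; group
  exact (Subgroup.mul_mem_cancel_left _ (inv_mem r.2)).1 (hc hcent)

theorem isCentricIn_of_centralizerIn_le (hP : P ≤ S) (h : centralizerIn S P ≤ P) :
    IsCentricIn S P :=
  le_antisymm (le_inf h inf_le_right) (inf_le_inf_right _ hP)

theorem isCentricIn_of_le (hP : P ≤ T) (hT : T ≤ S) (h : IsCentricIn S P) : IsCentricIn T P :=
  isCentricIn_of_centralizerIn_le hP
    ((inf_le_inf_right _ hT).trans (h.trans_le inf_le_left))

end ConjugationAutomorphisms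

namespace FusionSystem

variable {G : Type*} [Group G] {S : Subgroup G} {F : FusionSystem S} {p : ℕ}
  {E Q R R₁ : Subgroup G} {f χ : G → G}

/-- The restriction of `f` to `R` extends to an automorphism of `S` in `F`. -/
def ExtendsToTop (F : FusionSystem S) (R : Subgroup G) (f : G → G) : Prop :=
  ∃ f', F.IsoOn S S f' ∧ Set.EqOn f' f R

theorem mem_inducedAut_autF_iff (hR : R ≤ S) {β : MulAut R} :
    β ∈ inducedAut hR (F.autF le_rfl) ↔ F.ExtendsToTop R (extendFun β) := by
  constructor
  · rintro ⟨α, hα, h⟩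
    refine ⟨extendFun α, mem_autF_iff.1 hα, fun x hx => ?_⟩
    rw [extendFun_of_mem α (hR hx), extendFun_of_mem β hx, ← h]
    rfl
  · rintro ⟨f, hf, h⟩
    obtain ⟨α, hα, hαf⟩ := hf.exists_mem_autF
    exact ⟨α, hα, fun x => by rw [hαf, Subgroup.coe_inclusion, h x.2, extendFun_coe]⟩

theorem autConj_le_inducedAut_autF (hR : R ≤ S) :
    autConj S R ≤ inducedAut hR (F.autF le_rfl) :=
  inducedAut_innerAut hR ▸ inducedAut_mono hR (autConj_self S ▸ autConj_le_autF le_rfl)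

theorem innerAut_sup_inducedAut_le_autF (hR : R ≤ S) {C : Subgroup (MulAut S)}
    (hC : C ≤ F.autF le_rfl) : innerAut R ⊔ inducedAut hR C ≤ F.autF hR :=
  sup_le ((innerAut_le_autConj hR).trans (autConj_le_autF hR))
    ((inducedAut_mono hR hC).trans (inducedAut_autF_le hR le_rfl))

theorem Receptive.of_pairIso (h : F.Receptive R₁) (hχ : F.PairIso S R S R₁ χ) :
    F.Receptive R := by
  intro P Y f hf hY hYf
  obtain ⟨f', ⟨V, hf'⟩, he⟩ := h (hχ.isoOn_sub.comp hf) hY fun y hy => by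
    obtain ⟨t, ht, htf⟩ := hYf y hy
    refine ⟨χ t, hχ.isoOn.apply_mem ht, fun x hx => ?_⟩
    rw [Function.comp_apply, htf x hx, hχ.isoOn.map_conj ht (hf.cod_le (hf.apply_mem hx)),
      Function.comp_apply]
  obtain ⟨i, hi, hiχ⟩ := hχ.symm
  refine ⟨i ∘ f', hi.isoOn.morOn.comp hf' hf'.cod_le, fun x hx => ?_⟩
  rw [Function.comp_apply, he hx]
  exact hiχ.1 (hf.cod_le (hf.apply_mem hx))

theorem Automized.of_pairIso {hR₁ : R₁ ≤ S} (h : F.Automized p hR₁)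
    (hχ : F.PairIso S R S R₁ χ) : F.Automized p hχ.le := by
  obtain ⟨α, hα, hαχ⟩ := hχ.isoOn_sub
  have hα' := (F.iso_mem_of_comp_mem le_rfl α hα).2
  have hF : (F.autF hR₁).comap (MulAut.congr α).toMonoidHom = F.autF hχ.le := by
    ext β
    refine ⟨fun hβ => ?_, fun hβ => F.comp_mem hα (F.comp_mem hβ hα')⟩
    exact (MulAut.congr α).symm_apply_apply β ▸ F.comp_mem hα' (F.comp_mem hβ hα)
  have hconj : (autConj S R₁).comap (MulAut.congr α).toMonoidHom = autConj S R := by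
    have hval (β : MulAut R) (x : R) : (MulAut.congr α β (α x) : G) = χ (β x) := by
      rw [← hαχ]
      simp [MulAut.congr]
    ext β
    constructor
    · rintro ⟨s, hs, hβ⟩
      obtain ⟨t, ht, rfl⟩ := hχ.isoOn.surjOn hs
      refine ⟨t, ht, fun x => hχ.isoOn.injOn (hχ.le (β x).2)
        (S.mul_mem (S.mul_mem ht (hχ.le x.2)) (S.inv_mem ht)) ?_⟩
      rw [← hval, hχ.isoOn.map_conj ht (hχ.le x.2), ← hαχ]
      exact hβ (α x)
    · rintro ⟨t, ht, hβ⟩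
      refine ⟨χ t, hχ.isoOn.apply_mem ht, fun y => ?_⟩
      obtain ⟨x, rfl⟩ := α.surjective y
      rw [hαχ, ← hχ.isoOn.map_conj ht (hχ.le x.2), ← hβ]
      exact hval β x
  rwa [Automized, ← hF, ← hconj, Subgroup.relIndex_comap,
    Subgroup.map_comap_eq_self_of_surjective (MulAut.congr α).surjective]

theorem sylowReceptive_self {hR : R ≤ S} (ha : F.Automized p hR) (hr : F.Receptive R) :
    F.SylowReceptive p hR R := by
  refine ⟨le_rfl, hr, ?_⟩
  have htop : autStabilizer R R = ⊤ :=
    eq_top_iff.2 fun α _ x => ⟨fun _ => x.2, fun _ => (α x).2⟩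
  rwa [htop, inf_top_eq]

theorem IsCentric.centralizerIn_le (hE : F.IsCentric E) (hER : E ≤ R) (hf : F.IsoOn R Q f) :
    centralizerIn S Q ≤ Q := by
  obtain ⟨E', hE', hfE⟩ := hf.restrict hER
  have hcent : centralizerIn S E' ≤ E' := (hE E' hfE.isConjugate).trans_le inf_le_left
  exact (inf_le_inf_left S (Subgroup.centralizer_le hE')).trans (hcent.trans hE')

theorem mem_inducedAut_of_not_extensionControl_le (hr : F.Receptive R)
    (hext : ∀ X f, R < X → F.MorOn X f → F.ExtendsToTop X f) {hR : R ≤ S} {β : MulAut R}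
    (hβ : β ∈ F.autF hR) (h : ¬ extensionControl S β ≤ R) :
    β ∈ inducedAut hR (F.autF le_rfl) := by
  have hmem (g : G) := mem_extensionControl_iff (S := S) (g := g)
    fun x => (extendFun_coe β x).symm
  obtain ⟨f', hf', hβ'⟩ := hr (mem_autF_iff.1 hβ) (fun g hg => ((hmem g).1 hg).1)
    fun g hg => ((hmem g).1 hg).2
  obtain ⟨f'', hf'', he⟩ := hext _ f' (left_lt_sup.2 h) hf'
  exact (mem_inducedAut_autF_iff hR).2
    ⟨f'', hf'', fun x hx => (he (Subgroup.mem_sup_left hx)).trans (hβ' hx)⟩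

variable [Fact p.Prime] [Finite S]

theorem normalizerArrow_of_isoOn (hS : IsPGroup p S) {hR : R ≤ S} (ha : F.Automized p hR)
    (hr : F.Receptive R) (hf : F.IsoOn Q R f) : F.NormalizerArrow Q R := by
  obtain ⟨f', M, hf'⟩ := (sylowReceptive_self ha hr).exists_extension_normalizer hS ⟨le_rfl, hf, hf⟩
  exact ⟨f', M, by rwa [inf_idem] at hf'⟩

theorem automized_and_receptive_of_extendsToTop (hS : IsPGroup p S) (hR : R ≤ S)
    (h : F.SaturatedAt p R)
    (hext : ∀ f, F.MorOn (normalizerIn S R) f → F.ExtendsToTop (normalizerIn S R) f) :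
    F.Automized p hR ∧ F.Receptive R := by
  obtain ⟨R₁, hR₁, g, hg, ha, hr⟩ := h
  obtain ⟨f, M, hf⟩ := normalizerArrow_of_isoOn hS ha hr hg
  obtain ⟨χ, hχ, he⟩ := hext f hf.isoOn.morOn
  have hχR : F.PairIso S R S R₁ χ :=
    ⟨hR, hχ, hf.isoOn_sub.congr (he.mono (le_normalizerIn hR))⟩
  exact ⟨ha.of_pairIso hχR, hr.of_pairIso hχR⟩

theorem exists_isStronglyEmbedded (hS : IsPGroup p S) (hR : R < S) (hc : centralizerIn S R ≤ R)
    (ha : F.Automized p hR.le) (hr : F.Receptive R)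
    (hext : ∀ X f, R < X → F.MorOn X f → F.ExtendsToTop X f)
    (hne : ¬ F.autF hR.le ≤ inducedAut hR.le (F.autF le_rfl)) :
    ∃ M : Subgroup (F.outF hR.le), IsStronglyEmbedded p M := by
  have : Finite R := Finite.of_injective _ (Subgroup.inclusion_injective hR.le)
  refine ⟨_, isStronglyEmbedded_map_mk (P := (autConj S R).subgroupOf _)
    (M := (inducedAut hR.le (F.autF le_rfl)).subgroupOf _) (isPGroup_autConj hS).comap_subtype ha
    ?_ (Subgroup.comap_mono (autConj_le_inducedAut_autF hR.le))
    (fun htop => hne (Subgroup.subgroupOf_eq_top.1 htop)) ?_⟩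
  · obtain ⟨α, hα, hαi⟩ := SetLike.exists_of_lt (innerAut_lt_autConj hS hR hc)
    exact SetLike.lt_iff_le_and_exists.2 ⟨Subgroup.comap_mono (innerAut_le_autConj hR.le),
      ⟨α, autConj_le_autF hR.le hα⟩, hα, hαi⟩
  · rintro ⟨β, hβ⟩ ⟨α, _⟩ ⟨t, ht, hα⟩ hαi hβα
    refine mem_inducedAut_of_not_extensionControl_le hr hext hβ fun hle => hαi ?_
    have hαt : R.normalizerMonoidHom ⟨t, mem_normalizer_of_conj hα⟩ = α :=
      MulEquiv.ext fun x => Subtype.ext (hα x).symm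
    have htR : t ∈ R := hle ⟨ht, mem_normalizer_of_conj hα, by rw [hαt]; exact hβα⟩
    exact ⟨⟨t, htR⟩, MulEquiv.ext fun x => Subtype.ext (hα x).symm⟩

theorem isEssential_of_not_autF_le (hS : IsPGroup p S) (hE : F.IsCentric E) (hER : E ≤ R)
    (hR : R < S) (ha : F.Automized p hR.le) (hr : F.Receptive R)
    (hext : ∀ X f, R < X → F.MorOn X f → F.ExtendsToTop X f)
    (hne : ¬ F.autF hR.le ≤ inducedAut hR.le (F.autF le_rfl)) : F.IsEssential p R := by
  refine ⟨hR, fun Q hQ => ?_, fun Q hQ => ?_,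
    exists_isStronglyEmbedded hS hR (hE.centralizerIn_le hER (.refl hR.le)) ha hr hext hne⟩
  · obtain ⟨g, hg⟩ := isConjugate_iff.1 hQ
    exact isCentricIn_of_centralizerIn_le hg.cod_le (hE.centralizerIn_le hER hg)
  · obtain ⟨g, hg⟩ := isConjugate_iff.1 hQ
    obtain ⟨g', hg', -⟩ := hg.symm
    obtain ⟨f, M, hf⟩ := normalizerArrow_of_isoOn hS ha hr hg'
    exact hf.isoOn.card_eq.trans_le
      (card_le_of_le_of_le inf_le_left (hf.le_normalizerIn inf_le_right))

end FusionSystem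

namespace FusionSystem

variable {G : Type*} [Group G] {S : Subgroup G} {F : FusionSystem S} {p : ℕ} [Fact p.Prime]
  [Finite S] {E R : Subgroup G} {f : G → G}

theorem extendsToTop_of_autF_le (hS : IsPGroup p S) (hR : R < S) (ha : F.Automized p hR.le)
    (hr : F.Receptive R) (hext : ∀ X f, R < X → F.MorOn X f → F.ExtendsToTop X f)
    (haut : F.autF hR.le ≤ inducedAut hR.le (F.autF le_rfl)) (hf : F.MorOn R f) :
    F.ExtendsToTop R f := by
  obtain ⟨R', hf⟩ := hf
  have hR' : R' < S := hf.cod_le.lt_of_ne fun h =>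
    (card_lt_of_lt_of_le le_rfl hR).ne (hf.card_eq.trans (by rw [h]))
  obtain ⟨i, hi, -⟩ := hf.symm
  obtain ⟨ψ, M, hψ⟩ := normalizerArrow_of_isoOn hS ha hr hi
  have hRM : R < M := hψ.cod_le.lt_of_ne fun h =>
    (card_lt_of_lt_of_le (inf_le_left : normalizerIn S R' ≤ S) (lt_normalizerIn hS hR')).ne <|
      hψ.isoOn_sub.card_eq.trans
        ((by rw [h] : Nat.card R = Nat.card M).trans hψ.isoOn.card_eq.symm)
  obtain ⟨j, hj, hjψ⟩ := hψ.symm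
  obtain ⟨b, hb, hbj⟩ := hext M j hRM hj.isoOn.morOn
  obtain ⟨β, hβ, hβψ⟩ := (hψ.isoOn_sub.comp hf).exists_mem_autF
  obtain ⟨c, hc, hcβ⟩ := (mem_inducedAut_autF_iff hR.le).1 (haut hβ)
  refine ⟨b ∘ c, hb.comp hc, fun x hx => ?_⟩
  have hfx := hf.apply_mem hx
  rw [Function.comp_apply, hcβ hx, extendFun_of_mem _ hx, hβψ, Function.comp_apply,
    hbj (hRM.le (hψ.isoOn_sub.apply_mem hfx))]
  exact hjψ.1 (hψ.le hfx)

theorem extendsToTop_of_lt (hS : IsPGroup p S) (hF : F.IsSaturated p) (hE : F.IsCentric E)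
    (hmax : ∀ E', F.IsEssential p E' → E ≤ E' → E' = E) (hER : E < R) (hf : F.MorOn R f) :
    F.ExtendsToTop R f := by
  induction hn : Nat.card S - Nat.card R using Nat.strong_induction_on generalizing R f with
  | _ n ih =>
    obtain ⟨R', hf⟩ := hf
    rcases hf.dom_le.eq_or_lt with rfl | hR
    · obtain rfl : R' = R := eq_of_le_of_card_le le_rfl hf.cod_le hf.card_eq.le
      exact ⟨f, hf, Set.eqOn_refl _ _⟩
    have hext : ∀ X f, R < X → F.MorOn X f → F.ExtendsToTop X f := by
      rintro X f hRX ⟨V, hX⟩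
      have := card_lt_of_lt_of_le hX.dom_le hRX
      have := card_le_of_le_of_le le_rfl hX.dom_le
      exact ih _ (by omega) (hER.trans hRX) hX.morOn rfl
    obtain ⟨ha, hr⟩ := automized_and_receptive_of_extendsToTop hS hR.le
      ((isSaturated_iff hS).1 hF R hR.le) fun f => hext _ f (lt_normalizerIn hS hR)
    refine extendsToTop_of_autF_le hS hR ha hr hext ?_ hf.morOn
    by_contra hne
    exact hER.ne' (hmax R (isEssential_of_not_autF_le hS hE hER.le hR ha hr hext hne) hER.le)

theorem automized_self (hS : IsPGroup p S) (hF : F.IsSaturated p) :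
    F.Automized p (le_refl S) := by
  obtain ⟨Q, hQ, f, hf, ha, -⟩ := (isSaturated_iff hS).1 hF S le_rfl
  obtain rfl : Q = S := eq_of_le_of_card_le le_rfl hQ hf.card_eq.le
  exact ha

theorem automized_and_receptive_of_isCentric (hS : IsPGroup p S) (hF : F.IsSaturated p)
    (hE : F.IsCentric E) (hmax : ∀ E', F.IsEssential p E' → E ≤ E' → E' = E) (hES : E ≤ S) :
    F.Automized p hES ∧ F.Receptive E := by
  refine automized_and_receptive_of_extendsToTop hS hES ((isSaturated_iff hS).1 hF E hES)
    fun f hf => ?_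
  rcases hES.eq_or_lt with rfl | hlt
  · obtain ⟨E', hf⟩ := hf.restrict (le_normalizerIn le_rfl)
    obtain rfl : E' = E := eq_of_le_of_card_le le_rfl hf.cod_le hf.card_eq.le
    exact ⟨f, hf, Set.eqOn_refl _ _⟩
  · exact extendsToTop_of_lt hS hF hE hmax (lt_normalizerIn hS hlt) hf

theorem mem_inducedAut_stabilizer_of_not_extensionControl_le (hS : IsPGroup p S)
    (hF : F.IsSaturated p) (hES : E ≤ S) (hE : F.IsCentric E)
    (hmax : ∀ E', F.IsEssential p E' → E ≤ E' → E' = E) {δ : MulAut E} (hδ : δ ∈ F.autF hES)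
    (h : ¬ extensionControl S δ ≤ E) :
    δ ∈ inducedAut hES (F.autF le_rfl ⊓ autStabilizer S E) := by
  obtain ⟨α, hα, hαδ⟩ := mem_inducedAut_of_not_extensionControl_le
    (automized_and_receptive_of_isCentric hS hF hE hmax hES).2
    (fun X f hX hf => extendsToTop_of_lt hS hF hE hmax hX hf) hδ h
  exact ⟨α, ⟨hα, mem_autStabilizer_of_restrict hES hαδ⟩, hαδ⟩

end FusionSystem

section NormalizerTower

variable {G : Type*} [Group G] {S E Q : Subgroup G}

theorem apply_mem_normalizerIn (hQ : Q ≤ S) {α : MulAut S} (hα : α ∈ autStabilizer S Q) {x : S}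
    (hx : (x : G) ∈ normalizerIn S Q) : (α x : G) ∈ normalizerIn S Q := by
  have hconj : ∀ s : S, (s : G) ∈ normalizerIn S Q → ∀ y ∈ Q,
      (α s : G) * y * (α s : G)⁻¹ ∈ Q := by
    intro s hs y hy
    have hz : ((α⁻¹ ⟨y, hQ hy⟩ : S) : G) ∈ Q := (inv_mem hα ⟨y, hQ hy⟩).2 hy
    have hsz := (hα (s * α⁻¹ ⟨y, hQ hy⟩ * s⁻¹)).2 (Subgroup.le_normalizer_iff.1
      (inf_le_right : normalizerIn S Q ≤ _) s hs _ hz)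
    rwa [map_mul, map_mul, map_inv, MulAut.apply_inv_self] at hsz
  refine ⟨(α x).2, Subgroup.mem_normalizer_iff.2 fun y => ⟨hconj x hx y, fun hy => ?_⟩⟩
  simpa [mul_assoc] using hconj x⁻¹ (Subgroup.inv_mem _ hx) _ hy

theorem autStabilizer_le_autStabilizer_normalizerIn (hQ : Q ≤ S) :
    autStabilizer S Q ≤ autStabilizer S (normalizerIn S Q) := by
  refine fun α hα x => ⟨fun hx => ?_, apply_mem_normalizerIn hQ hα⟩
  simpa using apply_mem_normalizerIn hQ (inv_mem hα) hx

theorem autStabilizer_le_autStabilizer_normalizerTower (hE : E ≤ S) :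
    ∀ i, autStabilizer S E ≤ autStabilizer S (normalizerTower S E i)
  | 0 => le_rfl
  | i + 1 => (autStabilizer_le_autStabilizer_normalizerTower hE i).trans
      (autStabilizer_le_autStabilizer_normalizerIn (normalizerTower_le hE i))

theorem normalizerTower_mono (hE : E ≤ S) : Monotone (normalizerTower S E) :=
  monotone_nat_of_le_succ fun i => le_normalizerIn (normalizerTower_le hE i)

end NormalizerTower

section Complement

variable {G : Type*} [Group G] {S E T : Subgroup G} {A C : Subgroup (MulAut S)}

theorem card_inducedAut_dvd (hT : T ≤ S) (C : Subgroup (MulAut S)) :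
    Nat.card (inducedAut hT C) ∣ Nat.card C := by
  rw [inducedAut_eq_map]
  exact (Subgroup.card_map_dvd _ _).trans
    (Subgroup.card_comap_dvd_of_injective _ _ (Subgroup.subtype_injective _))

theorem autConj_eq_of_normalizerIn_le (hT : T ≤ S) (hN : normalizerIn S E ≤ T) :
    autConj T E = autConj S E :=
  le_antisymm (autConj_mono hT) fun _ ⟨t, ht, h⟩ =>
    ⟨t, hN ⟨ht, FusionSystem.mem_normalizer_of_conj h⟩, h⟩

theorem mem_normalizerIn_of_conj_mem_autStabilizer (hE : E ≤ S) {s : S}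
    (hs : MulAut.conj s ∈ autStabilizer S E) : (s : G) ∈ normalizerIn S E := by
  refine ⟨s.2, Subgroup.mem_normalizer_iff.2 fun y => ⟨fun hy => (hs ⟨y, hE hy⟩).2 hy, ?_⟩⟩
  intro hy
  have hyS : y ∈ S := (Subgroup.mul_mem_cancel_left _ s.2).1
    ((Subgroup.mul_mem_cancel_right _ (inv_mem s.2)).1 (hE hy))
  exact (hs ⟨y, hyS⟩).1 hy

theorem inducedAut_le_of_isComplement' (hES : E ≤ S)
    (hC : Subgroup.IsComplement' ((innerAut S ⊓ autStabilizer S E).subgroupOf A)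
      (C.subgroupOf A)) (hET : E ≤ T) (hT : T ≤ S) (hCT : C ≤ autStabilizer S T)
    (hN : normalizerIn S E ≤ T) :
    inducedAut hES A ≤ inducedAut hET (innerAut T ⊔ inducedAut hT C) := by
  rintro β ⟨a, ha, haβ⟩
  obtain ⟨⟨⟨n, hn⟩, c, hc⟩, hnc⟩ := hC.2 ⟨a, ha⟩
  obtain ⟨⟨s, hs⟩, hnE⟩ := Subgroup.mem_subgroupOf.1 hn
  have hsT : (s : G) ∈ T := hN (mem_normalizerIn_of_conj_mem_autStabilizer hES (hs ▸ hnE))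
  have hnc : MulAut.conj s * c = a := hs ▸ congrArg Subtype.val hnc
  have hcT := hCT hc
  refine ⟨MulAut.conj ⟨s, hsT⟩ * restrictAut hT ⟨c, hcT⟩,
    Subgroup.mul_mem_sup ⟨_, rfl⟩ ⟨c, hc, fun _ => rfl⟩, fun x => ?_⟩
  rw [← haβ, ← hnc]
  rfl

theorem FusionSystem.not_dvd_card_of_isComplement' {F : FusionSystem S} {p : ℕ} [Fact p.Prime]
    [Finite S] (hS : IsPGroup p S) (hF : F.IsSaturated p)
    (hA : A = F.autF le_rfl ⊓ autStabilizer S E) (hCA : C ≤ A)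
    (hC : Subgroup.IsComplement' ((innerAut S ⊓ autStabilizer S E).subgroupOf A)
      (C.subgroupOf A)) : ¬ p ∣ Nat.card C := by
  have hindex : Nat.card C = (innerAut S).relIndex A := by
    rw [← Nat.card_congr (Subgroup.subgroupOfEquivOfLe hCA).toEquiv, ← hC.symm.index_eq_card,
      ← Subgroup.relIndex, ← Subgroup.inf_relIndex_right, inf_assoc,
      inf_eq_right.2 (hA.trans_le inf_le_right), Subgroup.inf_relIndex_right]
  have ha : ¬ p ∣ (innerAut S).relIndex (F.autF le_rfl) := autConj_self S ▸ automized_self hS hF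
  exact fun hp => ha ((hindex ▸ hp).trans
    (relIndex_dvd_relIndex_of_normal _ (hA.trans_le inf_le_left)))

end Complement

theorem theorem5_general {G : Type*} [Group G] {p : ℕ} [Fact p.Prime]
    {S : Subgroup G} [Finite S] (hS : IsPGroup p S) {F : FusionSystem S} (hF : F.IsSaturated p)
    {E T : Subgroup G} (hES : E ≤ S) (hE : F.IsCentric E)
    (hmax : ∀ E', F.IsEssential p E' → E ≤ E' → E' = E)
    {A C : Subgroup (MulAut S)} (hA : A = F.autF le_rfl ⊓ autStabilizer S E) (hCA : C ≤ A)
    (hC : Subgroup.IsComplement' ((innerAut S ⊓ autStabilizer S E).subgroupOf A) (C.subgroupOf A))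
    (hN : normalizerIn S E ≤ T) (hT : T ≤ S) (hmin : ∀ P < E, ¬ IsCentricIn T P)
    (hCT : C ≤ autStabilizer S T) :
    (FusionSystem.generate T (autMorphisms (innerAut T ⊔ inducedAut hT C) ∪
      autMorphisms (F.autF hES))).IsSaturated p := by
  have : Finite T := Finite.of_injective _ (Subgroup.inclusion_injective hT)
  have hET : E ≤ T := (le_normalizerIn hES).trans hN
  refine FusionSystem.isSaturated_pairSystem (hS.to_le hT) le_sup_left ?_ hET ?_ ?_
    (fun δ hδ hle => ?_) fun P hP hc => hmin P hP ?_
  · rw [Subgroup.relIndex_sup_left]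
    exact fun hp => FusionSystem.not_dvd_card_of_isComplement' hS hF hA hCA hC
      (hp.trans ((Subgroup.relIndex_dvd_card _ _).trans (card_inducedAut_dvd hT C)))
  · exact (inducedAut_mono _ (FusionSystem.innerAut_sup_inducedAut_le_autF hT
      (hCA.trans (hA.trans_le inf_le_left)))).trans
      (FusionSystem.inducedAut_autF_le hET hT)
  · rw [autConj_eq_of_normalizerIn_le hT hN]
    exact (FusionSystem.automized_and_receptive_of_isCentric hS hF hE hmax hES).1
  · exact inducedAut_le_of_isComplement' hES hC hET hT hCT hN <| hA ▸
      FusionSystem.mem_inducedAut_stabilizer_of_not_extensionControl_le hS hF hES hE hmax hδ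
        fun h => hle ((extensionControl_mono hT δ).trans h)
  · exact isCentricIn_of_centralizerIn_le (hP.le.trans hET) hc

theorem theorem5 {G : Type*} [Group G] (p : ℕ) [Fact p.Prime]
    (S : Subgroup G) [Finite S] (hS : IsPGroup p S)
    (F : FusionSystem S) (hF : F.IsSaturated p)
    (E : Subgroup G) (hES : E ≤ S) (hE : F.IsEssential p E)
    (hmax : ∀ E' : Subgroup G, F.IsEssential p E' → E ≤ E' → E' = E)
    (A : Subgroup (MulAut S)) (hA : A = F.autF le_rfl ⊓ autStabilizer S E)
    (C : Subgroup (MulAut S)) (hCA : C ≤ A)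
    (hC : Subgroup.IsComplement' ((innerAut S ⊓ autStabilizer S E).subgroupOf A) (C.subgroupOf A))
    (hmin : ∀ P : Subgroup G, P < E → ¬ IsCentricIn (normalizerTower S E 1) P)
    (i : ℕ) (hi : 1 ≤ i) :
    C ≤ autStabilizer S (normalizerTower S E i) ∧
    (FusionSystem.generate (normalizerTower S E i)
      (autMorphisms (innerAut (normalizerTower S E i) ⊔
          inducedAut (normalizerTower_le hES i) C) ∪
        autMorphisms (F.autF hES))).IsSaturated p := by
  have hCi : C ≤ autStabilizer S (normalizerTower S E i) :=
    (hCA.trans (hA.trans_le inf_le_right)).trans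
      (autStabilizer_le_autStabilizer_normalizerTower hES i)
  have hN : normalizerIn S E ≤ normalizerTower S E i := normalizerTower_mono hES hi
  obtain ⟨-, hEc, -, -⟩ := hE
  exact ⟨hCi, theorem5_general hS hF hES hEc hmax hA hCA hC hN (normalizerTower_le hES i)
    (fun P hP h => hmin P hP (isCentricIn_of_le (hP.le.trans (le_normalizerIn hES)) hN h)) hCi⟩
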